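/- Theorem 5.1. Let $\mu\in C[0,1]$ be nonnegative with $\mu(0)\mu(1)>0$. There is a constant $c>0$, depending only on $\mu$, such that the following holds. Let $\Omega\subset\mathbb R^d$, $d\in\{1,2,3\}$, be a bounded convex polygonal (polyhedral) domain, let $X_h$ be the space of continuous piecewise linear functions, vanishing on $\partial\Omega$, over a finite conforming partition $\mathcal T_h$ of $\overline\Omega$ into $d$-simplexes, and let $P_h:L^2(\Omega)\to X_h$ be the $L^2(\Omega)$-orthogonal projection. Define $A_h:X_h\to X_h$ by $(A_h\varphi,\chi)=(\nabla\varphi,\nabla\chi)$ for all $\varphi,\chi\in X_h$, where $(\cdot,\cdot)$ is the $L^2(\Omega)$-inner product. Let $T>0$, $N\ge 1$, $\tau=T/N$, $t_n=n\tau$, let $v\in L^2(\Omega)$, and put $v_h=P_hv$. Let $u_h:[0,T]\to X_h$ be a solution of the semidiscrete problem (with source $f=0$) $$D_t^{[\mu]}u_h(t)+A_hu_h(t)=0,\quad 0<t\le T,\qquad u_h(0)=v_h,$$ where $$D_t^{[\mu]}u(t)=\int_0^1\partial_t^\alpha u(t)\,\mu(\alpha)\,d\alpha,\qquad \partial_t^\alpha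 u(t)=\frac1{\Gamma(1-\alpha)}\int_0^t(t-s)^{-\alpha}u'(s)\,ds;$$ a solution is understood to be absolutely continuous on $[0,T]$, with the integrals above absolutely convergent and the equation satisfied for every $t\in(0,T]$. Let $b_0,b_1,\dots$ be the backward-Euler convolution-quadrature weights, that is, the expansion coefficients at $\xi=0$ of $$\sum_{j=0}^\infty b_j\xi^j=\int_0^1\Big(\frac{1-\xi}{\tau}\Big)^{\alpha}\mu(\alpha)\,d\alpha,$$ and let $U_h^0=v_h$ and $U_h^1,\dots,U_h^N\in X_h$ solve $$\sum_{j=1}^n b_{n-j}U_h^j+A_hU_h^n=\Big(\sum_{j=1}^n b_{n-j}\Big)v_h,\qquad n=1,\dots,N.$$ Then $$\|u_h(t_n)-U_h^n\|_{L^2(\Omega)}\le c\,\tau\,t_n^{-1}\,\|v\|_{L^2(\Omega)},\qquad n=1,\dots,N.$$ -/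

import Mathlib

open MeasureTheory Set

noncomputable section

namespace DistributedOrder

/-! ### The domain, its triangulations and the finite element space -/

/-- A bounded convex polygonal (polyhedral) domain in `ℝ^d`: a nonempty open convex set whose
closure is the convex hull of finitely many points. -/
def IsConvexPolygonalDomain {d : ℕ} (Ω : Set (EuclideanSpace ℝ (Fin d))) : Prop :=
  IsOpen Ω ∧ Ω.Nonempty ∧ Convex ℝ Ω ∧
    ∃ S : Finset (EuclideanSpace ℝ (Fin d)), closure Ω = convexHull ℝ (S : Set _)

/-- `K` is a (conforming) partition of the closure of `Ω` into finitely many `d`-simplexes: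
a finite simplicial complex with underlying space `closure Ω`, every simplex of which is a face of
a simplex with `d + 1` vertices. -/
def IsTriangulation {d : ℕ} (Ω : Set (EuclideanSpace ℝ (Fin d)))
    (K : Geometry.SimplicialComplex ℝ (EuclideanSpace ℝ (Fin d))) : Prop :=
  K.faces.Finite ∧ K.space = closure Ω ∧
    ∀ s ∈ K.faces, ∃ t ∈ K.faces, s ⊆ t ∧ t.card = d + 1

/-- The finite element space of continuous piecewise linear functions over the triangulation `K`
that vanish on the boundary of `Ω`. Its members are extended by zero outside `Ω`; continuity of the
extension says exactly that the function is continuous on `closure Ω` and zero on the boundary. -/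
def feSpace {d : ℕ} (Ω : Set (EuclideanSpace ℝ (Fin d)))
    (K : Geometry.SimplicialComplex ℝ (EuclideanSpace ℝ (Fin d))) :
    Submodule ℝ (EuclideanSpace ℝ (Fin d) → ℝ) where
  carrier := {f | Continuous f ∧ (∀ x ∉ Ω, f x = 0) ∧
    ∀ s ∈ K.faces, ∃ g : EuclideanSpace ℝ (Fin d) →ᵃ[ℝ] ℝ,
      EqOn f g (convexHull ℝ (s : Set (EuclideanSpace ℝ (Fin d))))}
  add_mem' := by
    rintro f₁ f₂ ⟨c₁, z₁, a₁⟩ ⟨c₂, z₂, a₂⟩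
    refine ⟨c₁.add c₂, fun x hx => by simp [z₁ x hx, z₂ x hx], fun s hs => ?_⟩
    obtain ⟨g₁, h₁⟩ := a₁ s hs
    obtain ⟨g₂, h₂⟩ := a₂ s hs
    exact ⟨g₁ + g₂, fun x hx => by simp [h₁ hx, h₂ hx]⟩
  zero_mem' := ⟨continuous_const, fun _ _ => rfl, fun _ _ => ⟨0, fun _ _ => by simp⟩⟩
  smul_mem' := by
    rintro c f ⟨c₁, z₁, a₁⟩
    refine ⟨c₁.const_smul c, fun x hx => by simp [z₁ x hx], fun s hs => ?_⟩
    obtain ⟨g, h⟩ := a₁ s hs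
    exact ⟨c • g, fun x hx => by simp [h hx]⟩

/-- The `L²(Ω)` inner product `(f, g)`. -/
def l2Inner {d : ℕ} (Ω : Set (EuclideanSpace ℝ (Fin d)))
    (f g : EuclideanSpace ℝ (Fin d) → ℝ) : ℝ :=
  ∫ x in Ω, f x * g x

/-- The `L²(Ω)` norm (used for square integrable functions). -/
def l2Norm {d : ℕ} (Ω : Set (EuclideanSpace ℝ (Fin d)))
    (f : EuclideanSpace ℝ (Fin d) → ℝ) : ℝ :=
  (eLpNorm f 2 (volume.restrict Ω)).toReal

/-- The Dirichlet form `a(f, g) = (∇f, ∇g)`. It is used on the finite element space, where the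
gradient exists classically away from the (null) boundaries of the simplexes and coincides almost
everywhere with the weak gradient. -/
def dirichletForm {d : ℕ} (Ω : Set (EuclideanSpace ℝ (Fin d)))
    (f g : EuclideanSpace ℝ (Fin d) → ℝ) : ℝ :=
  ∫ x in Ω, inner ℝ (gradient f x) (gradient g x)

/-- `p = P_h v`: the `L²(Ω)`-orthogonal projection of `v` on the finite element space. -/
def IsL2Projection {d : ℕ} (Ω : Set (EuclideanSpace ℝ (Fin d)))
    (K : Geometry.SimplicialComplex ℝ (EuclideanSpace ℝ (Fin d)))
    (v p : EuclideanSpace ℝ (Fin d) → ℝ) : Prop :=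
  p ∈ feSpace Ω K ∧ ∀ χ ∈ feSpace Ω K, l2Inner Ω p χ = l2Inner Ω v χ

/-- `ψ = A_h φ`, where `A_h = -Δ_h : X_h → X_h` is the negative discrete Laplacian on the finite
element space `X_h`, given by `(A_h φ, χ) = (∇φ, ∇χ)` for all `χ ∈ X_h`. -/
def IsNegDiscreteLaplacian {d : ℕ} (Ω : Set (EuclideanSpace ℝ (Fin d)))
    (K : Geometry.SimplicialComplex ℝ (EuclideanSpace ℝ (Fin d)))
    (φ ψ : EuclideanSpace ℝ (Fin d) → ℝ) : Prop :=
  φ ∈ feSpace Ω K ∧ ψ ∈ feSpace Ω K ∧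
    ∀ χ ∈ feSpace Ω K, l2Inner Ω ψ χ = dirichletForm Ω φ χ

/-! ### The distributed order derivative and the semidiscrete problem -/

/-- The left-sided Caputo derivative of order `α ∈ (0, 1)` of a scalar function. -/
def caputo (α : ℝ) (y : ℝ → ℝ) (t : ℝ) : ℝ :=
  1 / Real.Gamma (1 - α) * ∫ s in (0 : ℝ)..t, (t - s) ^ (-α) * deriv y s

/-- The distributed order derivative `∫₀¹ (∂_t^α y)(t) μ(α) dα`. -/
def distCaputo (μ : ℝ → ℝ) (y : ℝ → ℝ) (t : ℝ) : ℝ :=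
  ∫ α in (0 : ℝ)..1, caputo α y t * μ α

/-- The integrals that define the distributed order derivative of `y` at `t` converge absolutely. -/
def DistCaputoExists (μ : ℝ → ℝ) (y : ℝ → ℝ) (t : ℝ) : Prop :=
  (∀ α ∈ Ioo (0 : ℝ) 1,
    IntervalIntegrable (fun s => (t - s) ^ (-α) * deriv y s) volume 0 t) ∧
  IntervalIntegrable (fun α => caputo α y t * μ α) volume 0 1

/-- `u` solves the homogeneous semidiscrete problem `D^[μ] u(t) + A_h u(t) = 0`, `0 < t ≤ T`,
`u(0) = vh`, in the finite element space. The function `u` is absolutely continuous in time (for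
functions in the finite dimensional space `X_h` this may be said pointwise in space) and its
distributed order derivative exists at every time. -/
structure IsSemidiscreteSolution {d : ℕ} (μ : ℝ → ℝ) (T : ℝ)
    (Ω : Set (EuclideanSpace ℝ (Fin d)))
    (K : Geometry.SimplicialComplex ℝ (EuclideanSpace ℝ (Fin d)))
    (vh : EuclideanSpace ℝ (Fin d) → ℝ) (u : ℝ → EuclideanSpace ℝ (Fin d) → ℝ) : Prop where
  mem : ∀ t ∈ Icc 0 T, u t ∈ feSpace Ω K
  init : u 0 = vh
  absCont : ∀ x, AbsolutelyContinuousOnInterval (fun t => u t x) 0 T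
  exists_deriv : ∀ t ∈ Ioc 0 T, ∀ x, DistCaputoExists μ (fun s => u s x) t
  equation : ∀ t ∈ Ioc 0 T,
    IsNegDiscreteLaplacian Ω K (u t) (fun x => -distCaputo μ (fun s => u s x) t)

/-! ### Convolution quadrature generated by the backward Euler method -/

/-- The generating function `ω(ξ) = ∫₀¹ ((1 - ξ)/τ)^α μ(α) dα` of the quadrature weights. -/
def cqGenerating (μ : ℝ → ℝ) (τ ξ : ℝ) : ℝ :=
  ∫ α in (0 : ℝ)..1, ((1 - ξ) / τ) ^ α * μ α

/-- The convolution quadrature weights `b_j`: the expansion coefficients at `ξ = 0` of the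
generating function, `ω(ξ) = ∑ b_j ξ^j`. -/
def cqWeight (μ : ℝ → ℝ) (τ : ℝ) (j : ℕ) : ℝ :=
  iteratedDeriv j (cqGenerating μ τ) 0 / (j.factorial : ℝ)

/-- `Q_n(φ) = ∑_{j=1}^n b_{n-j} φ^j` for a sequence `φ` in a real vector space. -/
def cqSum {V : Type*} [AddCommGroup V] [Module ℝ V] (μ : ℝ → ℝ) (τ : ℝ) (φ : ℕ → V) (n : ℕ) : V :=
  ∑ j ∈ Finset.Icc 1 n, cqWeight μ τ (n - j) • φ j

/-- `U` solves the fully discrete scheme `Q_n(U) + A_h U^n = Q_n(1) vh`, `n = 1, …, N`,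
with `U^0 = vh`, in the finite element space. -/
structure IsFullyDiscreteSolution {d : ℕ} (μ : ℝ → ℝ) (τ : ℝ) (N : ℕ)
    (Ω : Set (EuclideanSpace ℝ (Fin d)))
    (K : Geometry.SimplicialComplex ℝ (EuclideanSpace ℝ (Fin d)))
    (vh : EuclideanSpace ℝ (Fin d) → ℝ) (U : ℕ → EuclideanSpace ℝ (Fin d) → ℝ) : Prop where
  init : U 0 = vh
  equation : ∀ n ∈ Finset.Icc 1 N,
    IsNegDiscreteLaplacian Ω K (U n) (cqSum μ τ (fun _ => (1 : ℝ)) n • vh - cqSum μ τ U n)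

end DistributedOrder

end

/-! In an `L²`-orthonormal eigenbasis of A_h (`exists_basis_diagonal`) both problems decouple into
scalar ones with a parameter λ ≥ 0. With w(s) = ∫₀¹ s^α μ(α) dα, the Laplace transform of the scalar
solution with unit data is w(s)/(s(w(s)+λ)). By Cauchy's theorem, and because Im w > 0 on the upper
side of the negative half axis, this is the Stieltjes transform ∫ (s+r)⁻¹ dν(r) of a positive
measure ν on [0,∞) of mass at most 1 (`exists_stieltjes_measure`). So the exact scalar solution is ∫
e^{-rt} dν(r) (`eq_mixture_of_relaxation`).

Convolution quadrature replaces s by (1-ξ)/τ. The generating function of the scheme is therefore the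
same Stieltjes transform at that point, and the scalar discrete solution is ∫ (1+τr)^{-n} dν(r)
(`cqSum_mixture`): backward Euler for each decay rate r, averaged over the same ν. The error reduces
to |e^{-nx} - (1+x)^{-n}| ≤ 4/n for x ≥ 0 (`abs_exp_sub_inv_pow_le`), which is uniform in r and λ,
and 1/n = τ/t_n. Parseval's identity and the contractivity of P_h conclude.

The solution lives on [0,T] only, so Laplace inversion is replaced by a uniqueness argument. The
finite Laplace transform of the difference between the solution and the mixture is O(e^{-pT})
(`laplace_distCaputo`, `laplace_mixture`), and a continuous function on [0,T] with this property
vanishes (`eqOn_zero_of_laplace_bound`). -/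

open MeasureTheory Set

namespace DistributedOrder

open Filter Topology

/-! ### The finite element space, its inner product and its Dirichlet form. -/

section FiniteElement

variable {d : ℕ} {Ω : Set (EuclideanSpace ℝ (Fin d))}
  {K : Geometry.SimplicialComplex ℝ (EuclideanSpace ℝ (Fin d))}

theorem IsConvexPolygonalDomain.isCompact_closure (h : IsConvexPolygonalDomain Ω) :
    IsCompact (closure Ω) := by
  obtain ⟨-, -, -, S, hS⟩ := h
  rw [hS]
  exact S.finite_toSet.isCompact_convexHull ℝ

theorem IsConvexPolygonalDomain.volume_lt_top (h : IsConvexPolygonalDomain Ω) :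
    volume Ω < ⊤ :=
  (measure_mono subset_closure).trans_lt h.isCompact_closure.measure_lt_top

/-- A finite element function vanishing at all vertices vanishes identically. -/
theorem eq_zero_of_vertices (hK : IsTriangulation Ω K) {f : EuclideanSpace ℝ (Fin d) → ℝ}
    (hf : f ∈ feSpace Ω K) (h : ∀ s ∈ K.faces, ∀ x ∈ s, f x = 0) : f = 0 := by
  obtain ⟨-, hz, ha⟩ := hf
  funext x
  by_cases hx : x ∈ Ω
  · have hx' : x ∈ K.space := hK.2.1 ▸ subset_closure hx
    obtain ⟨s, hs, hxs⟩ := Geometry.SimplicialComplex.mem_space_iff.1 hx'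
    obtain ⟨g, hg⟩ := ha s hs
    rw [hg hxs]
    have hsub : convexHull ℝ (s : Set (EuclideanSpace ℝ (Fin d))) ⊆ g ⁻¹' {0} := by
      refine convexHull_min (fun y hy => ?_) ((convex_singleton (0 : ℝ)).affine_preimage g)
      rw [mem_preimage, ← hg (subset_convexHull ℝ _ hy), h s hs y hy]
      rfl
    exact hsub hxs
  · exact hz x hx

variable (Ω K) in
/-- Evaluation of finite element functions at finitely many points. -/
def evalOn (V : Finset (EuclideanSpace ℝ (Fin d))) : feSpace Ω K →ₗ[ℝ] (V → ℝ) where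
  toFun f x := f.1 x
  map_add' _ _ := rfl
  map_smul' _ _ := rfl

theorem evalOn_injective (hK : IsTriangulation Ω K) {V : Finset (EuclideanSpace ℝ (Fin d))}
    (hV : ∀ s ∈ K.faces, s ⊆ V) : Function.Injective (evalOn Ω K V) :=
  (injective_iff_map_eq_zero _).2 fun f hf => Subtype.ext
    (eq_zero_of_vertices hK f.2 fun s hs x hx => congrFun hf ⟨x, hV s hs hx⟩)

theorem exists_finset_vertices (hK : IsTriangulation Ω K) :
    ∃ V : Finset (EuclideanSpace ℝ (Fin d)), ∀ s ∈ K.faces, s ⊆ V := by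
  classical
  exact ⟨hK.1.toFinset.biUnion id, fun s hs x hx =>
    Finset.mem_biUnion.2 ⟨s, hK.1.mem_toFinset.2 hs, hx⟩⟩

theorem finiteDimensional_feSpace (hK : IsTriangulation Ω K) :
    FiniteDimensional ℝ (feSpace Ω K) := by
  obtain ⟨V, hV⟩ := exists_finset_vertices hK
  exact FiniteDimensional.of_injective _ (evalOn_injective hK hV)

theorem memLp_of_mem_feSpace (hΩ : IsConvexPolygonalDomain Ω)
    {f : EuclideanSpace ℝ (Fin d) → ℝ} (hf : f ∈ feSpace Ω K) :
    MemLp f 2 (volume.restrict Ω) := by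
  refine (hf.1.memLp_of_hasCompactSupport ?_).restrict Ω
  exact HasCompactSupport.intro hΩ.isCompact_closure fun x hx =>
    hf.2.1 x fun h => hx (subset_closure h)

theorem l2Inner_add_left {f₁ f₂ g : EuclideanSpace ℝ (Fin d) → ℝ}
    (h₁ : MemLp f₁ 2 (volume.restrict Ω)) (h₂ : MemLp f₂ 2 (volume.restrict Ω))
    (hg : MemLp g 2 (volume.restrict Ω)) :
    l2Inner Ω (f₁ + f₂) g = l2Inner Ω f₁ g + l2Inner Ω f₂ g := by
  unfold l2Inner
  refine Eq.trans ?_ (integral_add (h₁.integrable_mul hg) (h₂.integrable_mul hg))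
  simp [add_mul]

theorem l2Inner_smul_left (c : ℝ) (f g : EuclideanSpace ℝ (Fin d) → ℝ) :
    l2Inner Ω (c • f) g = c * l2Inner Ω f g := by
  unfold l2Inner
  rw [← integral_const_mul]
  simp [mul_assoc]

theorem l2Inner_comm (f g : EuclideanSpace ℝ (Fin d) → ℝ) : l2Inner Ω f g = l2Inner Ω g f := by
  simp [l2Inner, mul_comm]

theorem l2Inner_self_nonneg (f : EuclideanSpace ℝ (Fin d) → ℝ) : 0 ≤ l2Inner Ω f f :=
  integral_nonneg fun x => mul_self_nonneg (f x)

/-- A continuous function that is zero almost everywhere on an open set is zero there; outside Ω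
members of the space are zero by convention. This definiteness turns the form into a genuine inner
product. -/
theorem l2Inner_self_eq_zero (hΩ : IsConvexPolygonalDomain Ω)
    {f : EuclideanSpace ℝ (Fin d) → ℝ} (hf : f ∈ feSpace Ω K) (h : l2Inner Ω f f = 0) :
    f = 0 := by
  have hi := (memLp_of_mem_feSpace hΩ hf).integrable_mul (memLp_of_mem_feSpace hΩ hf)
  have h0 := (integral_eq_zero_iff_of_nonneg (fun x => mul_self_nonneg (f x)) hi).1 h
  have h1 : f =ᵐ[volume.restrict Ω] 0 := h0.mono fun x hx => mul_self_eq_zero.1 hx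
  have h2 := Measure.eqOn_open_of_ae_eq h1 hΩ.1 hf.1.continuousOn continuousOn_const
  funext x
  by_cases hx : x ∈ Ω
  · exact h2 hx
  · exact hf.2.1 x hx

theorem l2Norm_eq_sqrt {f : EuclideanSpace ℝ (Fin d) → ℝ}
    (hf : MemLp f 2 (volume.restrict Ω)) : l2Norm Ω f = √(l2Inner Ω f f) := by
  rw [l2Norm, hf.eLpNorm_eq_integral_rpow_norm (by norm_num) (by norm_num),
    ENNReal.toReal_ofReal (by positivity), Real.sqrt_eq_rpow, l2Inner]
  norm_num
  congr 2
  funext x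
  ring

theorem l2Inner_le_l2Norm_mul {f g : EuclideanSpace ℝ (Fin d) → ℝ}
    (hf : MemLp f 2 (volume.restrict Ω)) (hg : MemLp g 2 (volume.restrict Ω)) :
    l2Inner Ω f g ≤ l2Norm Ω f * l2Norm Ω g := by
  have hint : l2Inner Ω f g = inner ℝ (hf.toLp f) (hg.toLp g) := by
    rw [L2.inner_def]
    refine integral_congr_ae ?_
    filter_upwards [hf.coeFn_toLp, hg.coeFn_toLp] with x h1 h2
    simp [h1, h2, mul_comm]
  rw [hint]
  refine (real_inner_le_norm _ _).trans_eq ?_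
  simp [l2Norm]

/-- The finite element functions are almost everywhere differentiable with bounded gradient. -/
theorem ae_differentiableAt_of_mem_feSpace (hK : IsTriangulation Ω K)
    {f : EuclideanSpace ℝ (Fin d) → ℝ} (hf : f ∈ feSpace Ω K) :
    ∃ C : ℝ, ∀ᵐ x ∂(volume.restrict Ω), DifferentiableAt ℝ f x ∧ ‖gradient f x‖ ≤ C := by
  choose! g hg using hf.2.2
  have hlin : ∀ s ∈ K.faces, ∀ x ∈ interior (convexHull ℝ (s : Set (EuclideanSpace ℝ (Fin d)))),
      HasFDerivAt f (LinearMap.toContinuousLinearMap (g s).linear) x := by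
    intro s hs x hx
    have h1 : HasFDerivAt (g s) (LinearMap.toContinuousLinearMap (g s).linear) x := by
      have h2 : (g s : EuclideanSpace ℝ (Fin d) → ℝ) =
          fun y => LinearMap.toContinuousLinearMap (g s).linear y + g s 0 := by
        funext y
        have := (g s).map_vadd 0 y
        simpa using this
      rw [h2]
      exact (ContinuousLinearMap.hasFDerivAt _).add_const _
    refine h1.congr_of_eventuallyEq ?_
    filter_upwards [isOpen_interior.mem_nhds hx] with y hy
    exact hg s hs (interior_subset hy)
  have hfin := hK.1
  refine ⟨∑ s ∈ hfin.toFinset, ‖LinearMap.toContinuousLinearMap (g s).linear‖, ?_⟩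
  -- The frontier of a convex set is null. For a lower-dimensional face the hull is its own
  -- frontier, so almost every point lies in the interior of a full-dimensional simplex.
  have hnull : ∀ᵐ x ∂(volume.restrict Ω), ∀ s ∈ K.faces,
      x ∉ frontier (convexHull ℝ (s : Set (EuclideanSpace ℝ (Fin d)))) := by
    refine ae_restrict_of_ae ((ae_ball_iff hfin.countable).2 fun s _ => ?_)
    exact measure_eq_zero_iff_ae_notMem.1 ((convex_convexHull ℝ _).addHaar_frontier volume)
  have hmem : ∀ᵐ x ∂(volume.restrict Ω), x ∈ closure Ω :=
    (ae_restrict_mem measurableSet_closure).filter_mono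
      (ae_mono (Measure.restrict_mono subset_closure le_rfl))
  filter_upwards [hnull, hmem] with x hx hxΩ
  rw [← hK.2.1] at hxΩ
  obtain ⟨s, hs, hxs⟩ := Geometry.SimplicialComplex.mem_space_iff.1 hxΩ
  have hxi : x ∈ interior (convexHull ℝ (s : Set (EuclideanSpace ℝ (Fin d)))) := by
    by_contra hcon
    exact hx s hs ⟨subset_closure hxs, hcon⟩
  refine ⟨(hlin s hs x hxi).differentiableAt, ?_⟩
  rw [gradient, (hlin s hs x hxi).fderiv, LinearIsometryEquiv.norm_map]
  exact Finset.single_le_sum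
    (f := fun s => ‖LinearMap.toContinuousLinearMap (g s).linear‖)
    (fun _ _ => norm_nonneg _) (hfin.mem_toFinset.2 hs)

theorem memLp_gradient_of_mem_feSpace (hΩ : IsConvexPolygonalDomain Ω) (hK : IsTriangulation Ω K)
    {f : EuclideanSpace ℝ (Fin d) → ℝ} (hf : f ∈ feSpace Ω K) :
    MemLp (gradient f) 2 (volume.restrict Ω) := by
  obtain ⟨C, hC⟩ := ae_differentiableAt_of_mem_feSpace hK hf
  have : IsFiniteMeasure (volume.restrict Ω) := isFiniteMeasure_restrict.2 hΩ.volume_lt_top.ne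
  have hm : Measurable (gradient f) :=
    (LinearIsometryEquiv.continuous _).measurable.comp (measurable_fderiv ℝ f)
  exact MemLp.of_bound hm.aestronglyMeasurable C (hC.mono fun x hx => hx.2)

theorem integrable_inner_of_memLp {f g : EuclideanSpace ℝ (Fin d) → EuclideanSpace ℝ (Fin d)}
    {ν : Measure (EuclideanSpace ℝ (Fin d))} (hf : MemLp f 2 ν) (hg : MemLp g 2 ν) :
    Integrable (fun x => inner ℝ (f x) (g x)) ν := by
  refine (hf.norm.integrable_mul hg.norm).mono (hf.1.inner hg.1) (ae_of_all _ fun x => ?_)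
  simpa using norm_inner_le_norm (𝕜 := ℝ) (f x) (g x)

/-- `gradient` takes the value 0 where a function is not differentiable and need not be additive
there, so additivity holds only almost everywhere, off the skeleton of the triangulation. -/
theorem dirichletForm_add_left (hΩ : IsConvexPolygonalDomain Ω) (hK : IsTriangulation Ω K)
    {f₁ f₂ g : EuclideanSpace ℝ (Fin d) → ℝ} (h₁ : f₁ ∈ feSpace Ω K) (h₂ : f₂ ∈ feSpace Ω K)
    (hg : g ∈ feSpace Ω K) :
    dirichletForm Ω (f₁ + f₂) g = dirichletForm Ω f₁ g + dirichletForm Ω f₂ g := by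
  unfold dirichletForm
  have hg' := memLp_gradient_of_mem_feSpace hΩ hK hg
  rw [← integral_add
    (integrable_inner_of_memLp (memLp_gradient_of_mem_feSpace hΩ hK h₁) hg')
    (integrable_inner_of_memLp (memLp_gradient_of_mem_feSpace hΩ hK h₂) hg')]
  obtain ⟨_, hd₁⟩ := ae_differentiableAt_of_mem_feSpace hK h₁
  obtain ⟨_, hd₂⟩ := ae_differentiableAt_of_mem_feSpace hK h₂
  refine integral_congr_ae ?_
  filter_upwards [hd₁, hd₂] with x hx₁ hx₂
  rw [← inner_add_left]
  simp only [gradient]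
  rw [fderiv_add hx₁.1 hx₂.1, map_add]

theorem dirichletForm_smul_left (hK : IsTriangulation Ω K) (c : ℝ)
    {f : EuclideanSpace ℝ (Fin d) → ℝ} (hf : f ∈ feSpace Ω K)
    (g : EuclideanSpace ℝ (Fin d) → ℝ) :
    dirichletForm Ω (c • f) g = c * dirichletForm Ω f g := by
  unfold dirichletForm
  rw [← integral_const_mul]
  obtain ⟨_, hd⟩ := ae_differentiableAt_of_mem_feSpace hK hf
  refine integral_congr_ae ?_
  filter_upwards [hd] with x hx
  simp only [gradient]
  rw [fderiv_const_smul hx.1, map_smulₛₗ, inner_smul_left]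
  simp

theorem dirichletForm_comm (f g : EuclideanSpace ℝ (Fin d) → ℝ) :
    dirichletForm Ω f g = dirichletForm Ω g f := by
  simp only [dirichletForm, real_inner_comm]

theorem dirichletForm_self_nonneg (f : EuclideanSpace ℝ (Fin d) → ℝ) :
    0 ≤ dirichletForm Ω f f :=
  integral_nonneg fun _ => real_inner_self_nonneg

end FiniteElement

/-! ### Spectral decomposition of the discrete Laplacian. -/

/-- Simultaneous diagonalization of an inner product and a positive semidefinite form. -/
theorem exists_basis_diagonal {V : Type*} [AddCommGroup V] [Module ℝ V] [FiniteDimensional ℝ V]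
    (B a : V →ₗ[ℝ] V →ₗ[ℝ] ℝ) (hBs : ∀ x y, B x y = B y x) (hB0 : ∀ x, 0 ≤ B x x)
    (hB : ∀ x, B x x = 0 → x = 0) (has : ∀ x y, a x y = a y x) (ha : ∀ x, 0 ≤ a x x) :
    ∃ (n : ℕ) (e : Fin n → V) (lam : Fin n → ℝ), (∀ i, 0 ≤ lam i) ∧
      (∀ i x, a (e i) x = lam i * B (e i) x) ∧ ∀ x, B x x = ∑ i, B (e i) x ^ 2 := by
  let core : InnerProductSpace.Core ℝ V :=
    { inner := fun x y => B x y
      conj_inner_symm := fun x y => by simp [hBs]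
      re_inner_nonneg := fun x => by simpa using hB0 x
      add_left := fun x y z => by simp
      smul_left := fun x y r => by simp
      definite := fun x hx => hB x hx }
  let _ : NormedAddCommGroup V := core.toNormedAddCommGroup
  let _ : InnerProductSpace ℝ V := InnerProductSpace.ofCore core.toCore
  have hin : ∀ x y : V, inner ℝ x y = B x y := fun _ _ => rfl
  have : CompleteSpace V := FiniteDimensional.complete ℝ V
  -- The Riesz representative of `a` with respect to the inner product `B`. It is symmetric because
  -- `a` is, so the spectral theorem provides the basis, and the last claim is Parseval's identity.
  let A : V →ₗ[ℝ] V :=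
    { toFun := fun x => (InnerProductSpace.toDual ℝ V).symm (LinearMap.toContinuousLinearMap (a x))
      map_add' := fun x y => by simp
      map_smul' := fun c x => by simp }
  have hA : ∀ x y, inner ℝ (A x) y = a x y := fun x y => by
    simp [A, InnerProductSpace.toDual_symm_apply]
  have hsym : A.IsSymmetric := fun x y => by
    rw [hA, real_inner_comm, hA, has]
  let e := hsym.eigenvectorBasis rfl
  have hae : ∀ i x, a (e i) x = hsym.eigenvalues rfl i * B (e i) x := fun i x => by
    rw [← hA, hsym.apply_eigenvectorBasis, ← hin, inner_smul_left]
    simp [e]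
  refine ⟨_, e, hsym.eigenvalues rfl, fun i => ?_, hae, fun x => ?_⟩
  · have h1 := hae i (e i)
    rw [← hin, real_inner_self_eq_norm_sq, e.norm_eq_one] at h1
    have := ha (e i)
    linarith
  · rw [← hin, real_inner_self_eq_norm_sq, ← e.sum_sq_norm_inner_right x]
    simp [hin]

/-! ### Backward Euler for a single exponential. -/

/-- The rational approximation `(1 + x)⁻ⁿ` of `exp (-n x)` is accurate to order `1 / n`. -/
theorem abs_exp_sub_inv_pow_le {x : ℝ} (hx : 0 ≤ x) {n : ℕ} (hn : 1 ≤ n) :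
    |Real.exp (-(n * x)) - ((1 + x) ^ n)⁻¹| ≤ 4 / n := by
  have hnpos : (0 : ℝ) < n := by exact_mod_cast hn
  have h1x : (0 : ℝ) < 1 + x := by linarith
  have hexp : Real.exp (-(n * x)) = Real.exp (-x) ^ n := by
    rw [← Real.exp_nat_mul]; ring_nf
  have hle : Real.exp (-x) ≤ (1 + x)⁻¹ := by
    rw [Real.exp_neg]
    exact inv_anti₀ h1x (by linarith [Real.add_one_le_exp x])
  have hpos := Real.exp_pos (-x)
  have hmono : Real.exp (-x) ^ n ≤ ((1 + x) ^ n)⁻¹ := by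
    rw [← inv_pow]; exact pow_le_pow_left₀ hpos.le hle n
  rw [hexp, abs_sub_comm, abs_of_nonneg (by linarith)]
  have hbase : (1 + x)⁻¹ ≤ 1 := inv_le_one_of_one_le₀ (by linarith)
  -- The main argument uses the quadratic term of the binomial expansion, which is absent for n = 1;
  -- there the difference is at most 1.
  rcases Nat.lt_or_ge n 2 with h2 | h2
  · have : n = 1 := by omega
    subst this
    norm_num
    linarith
  -- One-step consistency error, from 1 - x ≤ e^{-x}. The factorization of aⁿ - bⁿ then accumulates
  -- it over n steps.
  have hdiff : (1 + x)⁻¹ - Real.exp (-x) ≤ x ^ 2 * (1 + x)⁻¹ := by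
    have h3 : 1 - x ≤ Real.exp (-x) := by linarith [Real.add_one_le_exp (-x)]
    have h4 : (1 + x)⁻¹ * (1 + x) = 1 := inv_mul_cancel₀ h1x.ne'
    have h5 : (1 - x) = (1 + x)⁻¹ * (1 - x ^ 2) := by
      calc (1 - x) = ((1 + x)⁻¹ * (1 + x)) * (1 - x) := by rw [h4]; ring
        _ = _ := by ring
    nlinarith
  have hpow : ((1 + x) ^ n)⁻¹ - Real.exp (-x) ^ n ≤ n * x ^ 2 * ((1 + x) ^ n)⁻¹ := by
    have hgeom : (1 + x)⁻¹ ^ n - Real.exp (-x) ^ n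
        ≤ n * (1 + x)⁻¹ ^ (n - 1) * ((1 + x)⁻¹ - Real.exp (-x)) := by
      rw [← (Commute.all (1 + x)⁻¹ (Real.exp (-x))).geom_sum₂_mul n]
      refine mul_le_mul_of_nonneg_right ?_ (by linarith)
      calc ∑ i ∈ Finset.range n, (1 + x)⁻¹ ^ i * Real.exp (-x) ^ (n - 1 - i)
          ≤ ∑ i ∈ Finset.range n, (1 + x)⁻¹ ^ (n - 1) := by
            refine Finset.sum_le_sum fun i hi => ?_
            have hi' : i + (n - 1 - i) = n - 1 := by
              have := Finset.mem_range.1 hi; omega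
            calc (1 + x)⁻¹ ^ i * Real.exp (-x) ^ (n - 1 - i)
                ≤ (1 + x)⁻¹ ^ i * (1 + x)⁻¹ ^ (n - 1 - i) := by gcongr
              _ = (1 + x)⁻¹ ^ (n - 1) := by rw [← pow_add, hi']
        _ = _ := by simp
    calc ((1 + x) ^ n)⁻¹ - Real.exp (-x) ^ n = (1 + x)⁻¹ ^ n - Real.exp (-x) ^ n := by
          rw [inv_pow]
      _ ≤ n * (1 + x)⁻¹ ^ (n - 1) * ((1 + x)⁻¹ - Real.exp (-x)) := hgeom
      _ ≤ n * (1 + x)⁻¹ ^ (n - 1) * (x ^ 2 * (1 + x)⁻¹) := by gcongr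
      _ = n * x ^ 2 * ((1 + x)⁻¹ ^ (n - 1) * (1 + x)⁻¹) := by ring
      _ = n * x ^ 2 * ((1 + x) ^ n)⁻¹ := by
          rw [← pow_succ, Nat.sub_add_cancel hn, inv_pow]
  refine hpow.trans ?_
  -- Source of the constant 4: the binomial theorem gives C(n,2) x² ≤ (1+x)ⁿ, and n² ≤ 4 C(n,2) for
  -- n ≥ 2, with equality at n = 2.
  have hbin : (n : ℝ) ^ 2 * x ^ 2 ≤ 4 * (1 + x) ^ n := by
    have h6 : (n.choose 2 : ℝ) * x ^ 2 ≤ (1 + x) ^ n := by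
      rw [add_comm, add_pow]
      have := Finset.single_le_sum (f := fun m => x ^ m * (1 : ℝ) ^ (n - m) * (n.choose m : ℝ))
        (fun i _ => by positivity) (Finset.mem_range.2 (show 2 < n + 1 by omega))
      simpa [mul_comm] using this
    rw [Nat.cast_choose_two] at h6
    have h7 : (2 : ℝ) ≤ n := by exact_mod_cast h2
    have h8 : (n : ℝ) ^ 2 ≤ 4 * (n * (n - 1) / 2) := by nlinarith
    nlinarith [sq_nonneg x]
  rw [← div_eq_mul_inv, div_le_div_iff₀ (by positivity) hnpos]
  linarith

/-! ### Uniqueness for finite Laplace transforms. -/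

/-- If the finite Laplace transform of a continuous function on `[0, T]` is `O(exp (-p T))` along
the real axis, then the function vanishes. -/
theorem eqOn_zero_of_laplace_bound {D : ℝ → ℝ} {T C : ℝ} (hT : 0 < T)
    (hD : ContinuousOn D (Icc 0 T))
    (h : ∀ p : ℝ, 1 ≤ p → |∫ t in (0 : ℝ)..T, Real.exp (-(p * t)) * D t| ≤
      C * Real.exp (-(p * T))) : EqOn D 0 (Icc 0 T) := by
  obtain ⟨M, hM⟩ := isCompact_Icc.exists_bound_of_continuousOn hD
  have huIcc : uIcc (0 : ℝ) T = Icc 0 T := uIcc_of_le hT.le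
  have huIoc : uIoc (0 : ℝ) T = Ioc 0 T := uIoc_of_le hT.le
  have hDint : IntervalIntegrable D volume 0 T := (huIcc ▸ hD).intervalIntegrable
  have hDm : AEStronglyMeasurable D (volume.restrict (uIoc 0 T)) :=
    huIoc ▸ hDint.1.aestronglyMeasurable
  have hM' : ∀ t ∈ uIoc (0 : ℝ) T, ‖D t‖ ≤ M := fun t ht =>
    hM t (Ioc_subset_Icc_self (huIoc ▸ ht))
  have hM0 : 0 ≤ M := (norm_nonneg _).trans (hM 0 (left_mem_Icc.2 hT.le))
  -- the smoothed cut-off is close to the total integral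
  have hcut : ∀ b ∈ Ioo 0 T, ∀ m : ℕ, 1 ≤ m →
      |(∫ t in (0 : ℝ)..T, Real.exp (-Real.exp (m * (b - t))) * D t) - ∫ t in (0 : ℝ)..T, D t| ≤
        C * (Real.exp (Real.exp (-(m * (T - b)))) - 1) := by
    intro b hb m hm
    -- Expanding the outer exponential of exp(-e^{m(b-t)}) turns the k-th term into the Laplace
    -- transform of `D` at p = km, weighted by e^{kmb}/k!. The term k = 0 is the plain integral; the
    -- others are at most C e^{-km(T-b)}/k! and sum to the stated bound.
    let F : ℕ → ℝ → ℝ := fun k t => (-Real.exp (m * (b - t))) ^ k / k.factorial * D t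
    have hFsum : HasSum (fun k => ∫ t in (0 : ℝ)..T, F k t)
        (∫ t in (0 : ℝ)..T, Real.exp (-Real.exp (m * (b - t))) * D t) := by
      refine intervalIntegral.hasSum_integral_of_dominated_convergence
        (fun k _ => Real.exp (m * b) ^ k / k.factorial * M) (fun k => ?_) (fun k => ?_) ?_ ?_ ?_
      · refine AEStronglyMeasurable.mul (Continuous.aestronglyMeasurable ?_) hDm
        fun_prop
      · refine ae_of_all _ fun t ht => ?_
        have ht0 : 0 < t := (huIoc ▸ ht : t ∈ Ioc 0 T).1
        simp only [F, norm_mul, norm_div, norm_pow, norm_neg, Real.norm_eq_abs, Real.abs_exp,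
          Nat.abs_cast]
        gcongr
        · nlinarith [(Nat.cast_nonneg m : (0 : ℝ) ≤ m)]
        · exact hM' t ht
      · exact ae_of_all _ fun t _ => (Real.summable_pow_div_factorial _).mul_right _
      · exact intervalIntegrable_const
      · refine ae_of_all _ fun t _ => ?_
        have := NormedSpace.expSeries_div_hasSum_exp (-Real.exp (m * (b - t)))
        rw [← Real.exp_eq_exp_ℝ] at this
        exact this.mul_right _
    have hF0 : ∫ t in (0 : ℝ)..T, F 0 t = ∫ t in (0 : ℝ)..T, D t := by simp [F]
    have hEsum : HasSum (fun k : ℕ => C * (Real.exp (-(m * (T - b))) ^ k / k.factorial))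
        (C * Real.exp (Real.exp (-(m * (T - b))))) := by
      have := NormedSpace.expSeries_div_hasSum_exp (Real.exp (-(m * (T - b))))
      rw [← Real.exp_eq_exp_ℝ] at this
      exact this.mul_left _
    have h1 := (hasSum_nat_add_iff' 1).2 hFsum
    have h2 := (hasSum_nat_add_iff' 1).2 hEsum
    simp only [Finset.range_one, Finset.sum_singleton, hF0] at h1 h2
    have h3 := h1.norm_le_of_bounded h2 fun k => by
      have hk1 : (1 : ℝ) ≤ (k + 1 : ℕ) * m := by
        exact_mod_cast Nat.one_le_iff_ne_zero.2 (by positivity)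
      have hFk : ∫ t in (0 : ℝ)..T, F (k + 1) t =
          (-1) ^ (k + 1) / ((k + 1).factorial : ℝ) * Real.exp ((k + 1 : ℕ) * m * b) *
            ∫ t in (0 : ℝ)..T, Real.exp (-((k + 1 : ℕ) * m * t)) * D t := by
        rw [← intervalIntegral.integral_const_mul]
        refine intervalIntegral.integral_congr fun t _ => ?_
        simp only [F]
        rw [neg_pow, ← Real.exp_nat_mul,
          show ((k + 1 : ℕ) : ℝ) * (m * (b - t)) =
            (k + 1 : ℕ) * m * b + -((k + 1 : ℕ) * m * t) by ring, Real.exp_add]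
        ring
      rw [hFk, norm_mul, norm_mul, norm_div, norm_pow, norm_neg, norm_one, one_pow,
        Real.norm_eq_abs, Real.norm_eq_abs, Real.norm_eq_abs, Nat.abs_cast, Real.abs_exp,
        ← Real.exp_nat_mul]
      calc _ ≤ 1 / ((k + 1).factorial : ℝ) * Real.exp ((k + 1 : ℕ) * m * b) *
            (C * Real.exp (-((k + 1 : ℕ) * m * T))) := by gcongr; exact h _ hk1
        _ = C * (Real.exp ((k + 1 : ℕ) * m * b) * Real.exp (-((k + 1 : ℕ) * m * T)) /
            ((k + 1).factorial : ℝ)) := by ring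
        _ = _ := by rw [← Real.exp_add]; ring_nf
    simpa [mul_sub] using h3
  -- As m → ∞ the cut-off tends to the indicator of t > b, while the error tends to 0 because b < T.
  -- Hence ∫_b^T D = ∫_0^T D.
  have hzero : ∀ b ∈ Ioo 0 T, ∫ t in (0 : ℝ)..b, D t = 0 := by
    intro b hb
    have hlim1 : Tendsto (fun m : ℕ => ∫ t in (0 : ℝ)..T, Real.exp (-Real.exp (m * (b - t))) * D t)
        atTop (𝓝 (∫ t in (0 : ℝ)..T, if t < b then 0 else D t)) := by
      refine intervalIntegral.tendsto_integral_filter_of_dominated_convergence (fun _ => M)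
        (Eventually.of_forall fun m => ?_) (Eventually.of_forall fun m => ?_)
        intervalIntegrable_const ?_
      · refine AEStronglyMeasurable.mul (Continuous.aestronglyMeasurable ?_) hDm
        fun_prop
      · refine ae_of_all _ fun t ht => ?_
        rw [norm_mul, Real.norm_eq_abs, Real.abs_exp]
        refine (mul_le_of_le_one_left (norm_nonneg _) ?_).trans (hM' t ht)
        exact Real.exp_le_one_iff.2 (neg_nonpos.2 (Real.exp_pos _).le)
      · filter_upwards [(measure_eq_zero_iff_ae_notMem.1 (measure_singleton b :
          volume {b} = 0))] with t htb _
        rw [mem_singleton_iff] at htb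
        rcases lt_or_gt_of_ne htb with hlt | hgt
        · rw [if_pos hlt]
          have h1 : Tendsto (fun m : ℕ => (m : ℝ) * (b - t)) atTop atTop :=
            tendsto_natCast_atTop_atTop.atTop_mul_const (by linarith)
          simpa using (Real.tendsto_exp_neg_atTop_nhds_zero.comp
            (Real.tendsto_exp_atTop.comp h1)).mul_const (D t)
        · rw [if_neg hgt.not_gt]
          have h1 : Tendsto (fun m : ℕ => (m : ℝ) * (b - t)) atTop atBot :=
            tendsto_natCast_atTop_atTop.atTop_mul_const_of_neg (by linarith)
          have h2 := (Real.tendsto_exp_atBot.comp h1).neg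
          simpa using ((Real.continuous_exp.tendsto _).comp h2).mul_const (D t)
    have hlim2 : Tendsto (fun m : ℕ => C * (Real.exp (Real.exp (-(m * (T - b)))) - 1))
        atTop (𝓝 0) := by
      have h1 : Tendsto (fun m : ℕ => (m : ℝ) * (T - b)) atTop atTop :=
        tendsto_natCast_atTop_atTop.atTop_mul_const (by linarith [hb.2])
      have h2 := (Real.continuous_exp.tendsto _).comp (Real.tendsto_exp_neg_atTop_nhds_zero.comp h1)
      simpa using (h2.sub_const 1).const_mul C
    have hle : |(∫ t in (0 : ℝ)..T, if t < b then 0 else D t) - ∫ t in (0 : ℝ)..T, D t| ≤ 0 := by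
      refine le_of_tendsto_of_tendsto (hlim1.sub_const _).abs hlim2 ?_
      filter_upwards [eventually_ge_atTop 1] with m hm using hcut b hb m hm
    have heq := sub_eq_zero.1 (abs_nonpos_iff.1 hle)
    have hI1 : IntervalIntegrable D volume 0 b :=
      hDint.mono_set (by rw [huIcc, uIcc_of_le hb.1.le]; exact Icc_subset_Icc_right hb.2.le)
    have hI2 : IntervalIntegrable D volume b T :=
      hDint.mono_set (by rw [huIcc, uIcc_of_le hb.2.le]; exact Icc_subset_Icc_left hb.1.le)
    have hJ1 : ∫ t in (0 : ℝ)..b, (if t < b then 0 else D t) = 0 := by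
      refine intervalIntegral.integral_zero_ae ?_
      filter_upwards [(measure_eq_zero_iff_ae_notMem.1 (measure_singleton b :
          volume {b} = 0))] with t htb ht
      rw [uIoc_of_le hb.1.le] at ht
      exact if_pos (lt_of_le_of_ne ht.2 htb)
    have hc : EqOn (fun t => if t < b then 0 else D t) D (uIcc b T) := fun t ht => by
      rw [uIcc_of_le hb.2.le] at ht
      exact if_neg ht.1.not_gt
    have hJ2 : ∫ t in b..T, (if t < b then 0 else D t) = ∫ t in b..T, D t :=
      intervalIntegral.integral_congr hc
    have hK1 : IntervalIntegrable (fun t => if t < b then 0 else D t) volume 0 b := by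
      refine (intervalIntegrable_const (c := (0 : ℝ))).congr_ae ?_
      rw [uIoc_of_le hb.1.le]
      filter_upwards [ae_restrict_mem measurableSet_Ioc, ae_restrict_of_ae
        (measure_eq_zero_iff_ae_notMem.1 (measure_singleton b : volume {b} = 0))] with t ht htb
      exact (if_pos (lt_of_le_of_ne ht.2 htb)).symm
    have hK2 : IntervalIntegrable (fun t => if t < b then 0 else D t) volume b T :=
      hI2.congr fun t ht => (hc (uIoc_subset_uIcc ht)).symm
    rw [← intervalIntegral.integral_add_adjacent_intervals hK1 hK2, hJ1, hJ2,
      ← intervalIntegral.integral_add_adjacent_intervals hI1 hI2] at heq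
    linarith
  have hopen : EqOn D 0 (Ioo 0 T) := by
    intro b hb
    have hcont : ContinuousAt D b := hD.continuousAt (Icc_mem_nhds hb.1 hb.2)
    have hI1 : IntervalIntegrable D volume 0 b :=
      hDint.mono_set (by rw [huIcc, uIcc_of_le hb.1.le]; exact Icc_subset_Icc_right hb.2.le)
    have hd := intervalIntegral.integral_hasDerivAt_right hI1
      (hD.mono Ioo_subset_Icc_self |>.stronglyMeasurableAtFilter isOpen_Ioo b hb) hcont
    have hd0 : HasDerivAt (fun u => ∫ t in (0 : ℝ)..u, D t) 0 b := by
      refine (hasDerivAt_const b (0 : ℝ)).congr_of_eventuallyEq ?_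
      filter_upwards [isOpen_Ioo.mem_nhds hb] with u hu using hzero u hu
    exact hd.unique hd0
  have hcl := hopen.of_subset_closure hD continuousOn_const Ioo_subset_Icc_self
    (by rw [closure_Ioo hT.ne])
  exact hcl

/-! ### The Laplace transform of the distributed order derivative. -/

/-- The symbol `w(s) = ∫₀¹ s^α μ(α) dα` of the distributed order derivative. -/
noncomputable def symbol (μ : ℝ → ℝ) (s : ℝ) : ℝ := ∫ α in (0 : ℝ)..1, s ^ α * μ α

/-- The kernel `x^(-α) exp (-p x)`, extended by zero to `x ≤ 0`. -/
noncomputable def expKernel (p α x : ℝ) : ℝ :=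
  if 0 < x then x ^ (-α) * Real.exp (-(p * x)) else 0

theorem expKernel_nonneg (p α x : ℝ) : 0 ≤ expKernel p α x := by
  unfold expKernel
  split_ifs with h
  · positivity
  · exact le_rfl

theorem measurable_expKernel (p : ℝ) : Measurable fun q : ℝ × ℝ => expKernel p q.1 q.2 := by
  unfold expKernel
  refine Measurable.ite (measurableSet_lt measurable_const measurable_snd) ?_ measurable_const
  fun_prop

theorem expKernel_eq_indicator (p α : ℝ) :
    expKernel p α = (Ioi 0).indicator fun x => x ^ (-α) * Real.exp (-(p * x)) := by
  funext x
  simp [expKernel, indicator_apply]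

section

variable {p α : ℝ}

theorem integral_expKernel (hp : 0 < p) (hα : α < 1) :
    ∫ x, expKernel p α x = p ^ (α - 1) * Real.Gamma (1 - α) := by
  rw [expKernel_eq_indicator, integral_indicator measurableSet_Ioi]
  have := Real.integral_rpow_mul_exp_neg_mul_Ioi (a := 1 - α) (by linarith) hp
  rw [show (1 : ℝ) - α - 1 = -α by ring] at this
  rw [this, one_div, Real.inv_rpow hp.le, ← Real.rpow_neg hp.le, neg_sub]

theorem integrable_expKernel (hp : 0 < p) (hα : α < 1) : Integrable (expKernel p α) := by
  refine Integrable.of_integral_ne_zero ?_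
  rw [integral_expKernel hp hα]
  have := Real.Gamma_pos_of_pos (show 0 < 1 - α by linarith)
  positivity

/-- Truncating the convolution with the exponential kernel at `T` costs `exp (-p (T - s))`. -/
theorem setIntegral_expKernel_bounds (hp : 0 < p) (hα0 : 0 ≤ α) (hα : α < 1) {s T : ℝ}
    (hs : s ∈ Ioo 0 T) :
    ∫ t in Ioc 0 T, expKernel p α (t - s) ≤ ∫ x, expKernel p α x ∧
      (1 - Real.exp (-(p * (T - s)))) * ∫ x, expKernel p α x ≤
        ∫ t in Ioc 0 T, expKernel p α (t - s) := by
  have hi := integrable_expKernel hp hα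
  have his := hi.comp_sub_right s
  have hshift : ∫ t, expKernel p α (t - s) = ∫ x, expKernel p α x :=
    integral_sub_right_eq_self _ s
  refine ⟨hshift ▸ setIntegral_le_integral his (ae_of_all _ fun t => expKernel_nonneg _ _ _), ?_⟩
  have hIoc : ∫ t in Ioc 0 T, expKernel p α (t - s) = ∫ t in Iic T, expKernel p α (t - s) := by
    refine (setIntegral_eq_of_subset_of_forall_sdiff_eq_zero measurableSet_Iic
      Ioc_subset_Iic_self fun t ht => ?_).symm
    have : ¬ 0 < t - s := fun h => ht.2 ⟨by linarith [hs.1], ht.1⟩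
    simp [expKernel, this]
  have hsplit := intervalIntegral.integral_Iic_add_Ioi (b := T) his.integrableOn his.integrableOn
  -- Beyond T, moving the singularity from s to T can only increase the power, since α ≥ 0, while
  -- the exponential releases the factor e^{-p(T-s)}.
  have htail : ∫ t in Ioi T, expKernel p α (t - s) ≤
      Real.exp (-(p * (T - s))) * ∫ x, expKernel p α x := by
    have hiT := hi.comp_sub_right T
    calc ∫ t in Ioi T, expKernel p α (t - s)
        ≤ ∫ t in Ioi T, Real.exp (-(p * (T - s))) * expKernel p α (t - T) := by
          refine setIntegral_mono_on his.integrableOn (hiT.const_mul _).integrableOn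
            measurableSet_Ioi fun t ht => ?_
          have htT : 0 < t - T := sub_pos.2 ht
          have hts : 0 < t - s := by linarith [hs.2]
          rw [expKernel, expKernel, if_pos htT, if_pos hts, mul_left_comm, ← Real.exp_add,
            show -(p * (T - s)) + -(p * (t - T)) = -(p * (t - s)) by ring]
          refine mul_le_mul_of_nonneg_right ?_ (Real.exp_pos _).le
          exact Real.rpow_le_rpow_of_nonpos htT (by linarith [hs.2]) (by linarith)
      _ = Real.exp (-(p * (T - s))) * ∫ t in Ioi T, expKernel p α (t - T) :=
          integral_const_mul _ _
      _ ≤ Real.exp (-(p * (T - s))) * ∫ t, expKernel p α (t - T) := by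
          refine mul_le_mul_of_nonneg_left ?_ (Real.exp_pos _).le
          exact setIntegral_le_integral hiT (ae_of_all _ fun t => expKernel_nonneg _ _ _)
      _ = _ := by rw [integral_sub_right_eq_self]
  rw [hIoc]
  linarith

end

theorem absolutelyContinuousOnInterval_exp (p T : ℝ) :
    AbsolutelyContinuousOnInterval (fun t => Real.exp (-(p * t))) 0 T := by
  refine ContDiffOn.absolutelyContinuousOnInterval (ContDiff.contDiffOn ?_)
  fun_prop

section

variable {μ : ℝ → ℝ}

theorem integrableOn_weight (hμc : ContinuousOn μ (Icc 0 1)) : IntegrableOn μ (Ioo 0 1) :=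
  hμc.integrableOn_Icc.mono_set Ioo_subset_Icc_self

/-- The finite Laplace transform of the distributed order derivative, up to an error that is
exponentially small at the rate given by the length of the interval. -/
theorem laplace_distCaputo (hμc : ContinuousOn μ (Icc 0 1)) (hμ0 : ∀ α ∈ Icc (0 : ℝ) 1, 0 ≤ μ α)
    {T : ℝ} (hT : 0 < T) {y : ℝ → ℝ} (hy : AbsolutelyContinuousOnInterval y 0 T) :
    ∃ C : ℝ, ∀ p : ℝ, 1 ≤ p →
      IntervalIntegrable (fun t => Real.exp (-(p * t)) * distCaputo μ y t) volume 0 T ∧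
      |(∫ t in (0 : ℝ)..T, Real.exp (-(p * t)) * distCaputo μ y t) -
        symbol μ p / p * (p * (∫ t in (0 : ℝ)..T, Real.exp (-(p * t)) * y t) - y 0)| ≤
        C * Real.exp (-(p * T)) := by
  set g := deriv y with hg
  -- The order stays in the open interval, where Γ(1-α) is finite and positive and the kernel is
  -- integrable.
  set mA : Measure ℝ := volume.restrict (Ioo 0 1)
  set mS : Measure ℝ := volume.restrict (Ioo 0 T)
  set mT : Measure ℝ := volume.restrict (Ioc 0 T)
  have hμi : Integrable μ mA := integrableOn_weight hμc
  have hgi : Integrable g mS := by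
    have := hy.intervalIntegrable_deriv
    rw [intervalIntegrable_iff_integrableOn_Ioo_of_le hT.le] at this
    exact this
  have hprod : ∀ᵐ q ∂(mA.prod mS), q.1 ∈ Ioo (0 : ℝ) 1 ∧ q.2 ∈ Ioo 0 T := by
    rw [Measure.prod_restrict]
    exact ae_restrict_mem (measurableSet_Ioo.prod measurableSet_Ioo)
  let c : ℝ → ℝ := fun α => μ α / Real.Gamma (1 - α)
  have hcm : AEStronglyMeasurable c mA := by
    refine ContinuousOn.aestronglyMeasurable (fun α hα => ?_) measurableSet_Ioo
    have h1 : ContinuousAt (fun α => Real.Gamma (1 - α)) α := by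
      refine ContinuousAt.comp (f := fun α : ℝ => 1 - α) (g := Real.Gamma) ?_ (by fun_prop)
      refine (Real.differentiableAt_Gamma fun m => ?_).continuousAt
      have : (0 : ℝ) ≤ m := m.cast_nonneg
      have := hα.2
      linarith
    exact ((hμc.mono Ioo_subset_Icc_self) α hα).div h1.continuousWithinAt
      (Real.Gamma_pos_of_pos (by linarith [hα.2])).ne'
  have hJ : Integrable (fun q : ℝ × ℝ => μ q.1 * |g q.2|) (mA.prod mS) := hμi.mul_prod hgi.norm
  -- The first summand pays for truncating the kernel at T, the second for the boundary term y(T)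
  -- e^{-pT} of the integration by parts. Both are free of p because p^{α-1} ≤ 1 for p ≥ 1.
  refine ⟨(∫ q, μ q.1 * |g q.2| ∂(mA.prod mS)) + (∫ α, μ α ∂mA) * |y T|, fun p hp => ?_⟩
  have hp0 : 0 < p := by linarith
  have hpow : ∀ α ∈ Ioo (0 : ℝ) 1, p ^ (α - 1) ≤ 1 := fun α hα =>
    Real.rpow_le_one_of_one_le_of_nonpos hp (by linarith [hα.2])
  -- The integrand of the triple integral over (α, s) and t. Splitting e^{-pt} as e^{-ps}
  -- e^{-p(t-s)} makes its t-integral a truncated integral of the kernel, so Fubini's theorem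
  -- evaluates the transform.
  let f : (ℝ × ℝ) × ℝ → ℝ := fun q =>
    c q.1.1 * (g q.1.2 * Real.exp (-(p * q.1.2))) * expKernel p q.1.1 (q.2 - q.1.2)
  have hfm : AEStronglyMeasurable f ((mA.prod mS).prod mT) := by
    refine AEStronglyMeasurable.mul ?_ ?_
    · have h1 : AEStronglyMeasurable (fun q : ℝ × ℝ => c q.1 * (g q.2 * Real.exp (-(p * q.2))))
          (mA.prod mS) := by
        have h2 : AEStronglyMeasurable (fun s => g s * Real.exp (-(p * s))) mS :=
          hgi.1.mul (Continuous.aestronglyMeasurable (by fun_prop))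
        exact hcm.comp_fst.mul h2.comp_snd
      exact h1.comp_fst
    · refine Measurable.aestronglyMeasurable ?_
      exact (measurable_expKernel p).comp
        ((measurable_fst.comp measurable_fst).prodMk
          (measurable_snd.sub (measurable_snd.comp measurable_fst)))
  have hcG : ∀ α ∈ Ioo (0 : ℝ) 1, c α * ∫ x, expKernel p α x = p ^ (α - 1) * μ α := by
    intro α hα
    rw [integral_expKernel hp0 hα.2]
    have := (Real.Gamma_pos_of_pos (show 0 < 1 - α by linarith [hα.2])).ne'
    simp only [c]
    field_simp
  have hc0 : ∀ α ∈ Ioo (0 : ℝ) 1, 0 ≤ c α := fun α hα =>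
    div_nonneg (hμ0 α (Ioo_subset_Icc_self hα))
      (Real.Gamma_pos_of_pos (show 0 < 1 - α by linarith [hα.2])).le
  have hfi : Integrable f ((mA.prod mS).prod mT) := by
    rw [integrable_prod_iff hfm]
    constructor
    · filter_upwards [hprod] with q hq
      exact (((integrable_expKernel hp0 hq.1.2).comp_sub_right q.2).const_mul
        (c q.1 * (g q.2 * Real.exp (-(p * q.2))))).restrict
    · refine hJ.mono' hfm.norm.integral_prod_right' ?_
      filter_upwards [hprod] with q hq
      have h1 := (setIntegral_expKernel_bounds hp0 hq.1.1.le hq.1.2 hq.2).1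
      have h2 : 0 ≤ ∫ t in Ioc 0 T, expKernel p q.1 (t - q.2) :=
        integral_nonneg fun t => expKernel_nonneg _ _ _
      have h3 : ∫ t, ‖f (q, t)‖ ∂mT =
          c q.1 * (|g q.2| * Real.exp (-(p * q.2))) * ∫ t in Ioc 0 T, expKernel p q.1 (t - q.2) := by
        rw [← integral_const_mul]
        refine integral_congr_ae (ae_of_all _ fun t => ?_)
        simp [f, abs_of_nonneg (hc0 _ hq.1), abs_of_nonneg (expKernel_nonneg _ _ _)]
      have h4 : Real.exp (-(p * q.2)) ≤ 1 :=
        Real.exp_le_one_iff.2 (neg_nonpos.2 (mul_nonneg hp0.le hq.2.1.le))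
      have h5 := hc0 _ hq.1
      rw [h3, Real.norm_of_nonneg (by positivity)]
      calc _ ≤ c q.1 * (|g q.2| * 1) * ∫ x, expKernel p q.1 x := by gcongr
        _ = (c q.1 * ∫ x, expKernel p q.1 x) * |g q.2| := by ring
        _ = p ^ (q.1 - 1) * μ q.1 * |g q.2| := by rw [hcG _ hq.1]
        _ ≤ 1 * μ q.1 * |g q.2| := by
            have := hμ0 _ (Ioo_subset_Icc_self hq.1)
            gcongr
            exact hpow _ hq.1
        _ = _ := by rw [one_mul]
  have hinner : (fun t => ∫ q, f (q, t) ∂(mA.prod mS)) =ᵐ[mT]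
      fun t => Real.exp (-(p * t)) * distCaputo μ y t := by
    filter_upwards [hfi.prod_left_ae, ae_restrict_mem measurableSet_Ioc] with t hti ht
    rw [integral_prod _ hti, distCaputo, intervalIntegral.integral_of_le zero_le_one,
      integral_Ioc_eq_integral_Ioo, ← integral_const_mul]
    refine integral_congr_ae ?_
    filter_upwards [ae_restrict_mem measurableSet_Ioo] with α hα
    have h1 : ∫ s, f ((α, s), t) ∂mS =
        ∫ s in Ioo 0 t, c α * Real.exp (-(p * t)) * ((t - s) ^ (-α) * g s) := by
      rw [setIntegral_eq_of_subset_of_forall_sdiff_eq_zero (s := Ioo 0 t) (t := Ioo 0 T)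
        measurableSet_Ioo (Ioo_subset_Ioo_right ht.2) fun s hs => ?_]
      · refine setIntegral_congr_fun measurableSet_Ioo fun s hs => ?_
        have hts : 0 < t - s := sub_pos.2 hs.2
        simp only [f, expKernel, if_pos hts]
        rw [show -(p * t) = -(p * s) + -(p * (t - s)) by ring, Real.exp_add]
        ring
      · have : ¬ 0 < t - s := fun h => hs.2 ⟨hs.1.1, sub_pos.1 h⟩
        simp only [f, expKernel, if_neg this, mul_zero]
    rw [h1, integral_const_mul, caputo, intervalIntegral.integral_of_le ht.1.le,
      integral_Ioc_eq_integral_Ioo]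
    simp only [c]
    ring
  have hswap : ∫ t, (∫ q, f (q, t) ∂(mA.prod mS)) ∂mT =
      ∫ q, (∫ t, f (q, t) ∂mT) ∂(mA.prod mS) :=
    (integral_integral_swap (f := fun q t => f (q, t)) hfi).symm
  have hwi : Integrable (fun α => p ^ (α - 1) * μ α) mA := by
    refine hμi.mono ((Continuous.aestronglyMeasurable ?_).mul hμi.1) ?_
    · exact Real.continuous_const_rpow hp0.ne' |>.comp (by fun_prop)
    · filter_upwards [ae_restrict_mem measurableSet_Ioo] with α hα
      rw [norm_mul, Real.norm_of_nonneg (by positivity)]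
      exact mul_le_of_le_one_left (norm_nonneg _) (hpow α hα)
  have hwsym : ∫ α, p ^ (α - 1) * μ α ∂mA = symbol μ p / p := by
    rw [symbol, intervalIntegral.integral_of_le zero_le_one, integral_Ioc_eq_integral_Ioo,
      ← integral_div]
    refine integral_congr_ae (ae_of_all _ fun α => ?_)
    simp only [Real.rpow_sub_one hp0.ne']
    ring
  have hgei : Integrable (fun s => g s * Real.exp (-(p * s))) mS := by
    refine hgi.mono (hgi.1.mul (Continuous.aestronglyMeasurable (by fun_prop))) ?_
    filter_upwards [ae_restrict_mem measurableSet_Ioo] with s hs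
    rw [norm_mul, Real.norm_eq_abs (Real.exp _), Real.abs_exp]
    exact mul_le_of_le_one_right (norm_nonneg _)
      (Real.exp_le_one_iff.2 (neg_nonpos.2 (mul_nonneg hp0.le hs.1.le)))
  -- The truncation loss e^{-p(T-s)} times the weight e^{-ps} equals e^{-pT}, uniformly in s.
  have hmain : |(∫ q, (∫ t, f (q, t) ∂mT) ∂(mA.prod mS)) -
      symbol μ p / p * ∫ s, g s * Real.exp (-(p * s)) ∂mS| ≤
      (∫ q, μ q.1 * |g q.2| ∂(mA.prod mS)) * Real.exp (-(p * T)) := by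
    rw [← hwsym, ← integral_prod_mul, ← integral_sub hfi.integral_prod_left (hwi.mul_prod hgei),
      ← integral_mul_const]
    rw [← Real.norm_eq_abs]
    refine norm_integral_le_of_norm_le (hJ.mul_const _) ?_
    filter_upwards [hprod] with q hq
    obtain ⟨h1, h2⟩ := setIntegral_expKernel_bounds hp0 hq.1.1.le hq.1.2 hq.2
    have h3 : ∫ t, f (q, t) ∂mT =
        c q.1 * (g q.2 * Real.exp (-(p * q.2))) * ∫ t in Ioc 0 T, expKernel p q.1 (t - q.2) := by
      rw [← integral_const_mul]
    have h5 := hc0 _ hq.1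
    have h6 : |(∫ t in Ioc 0 T, expKernel p q.1 (t - q.2)) - ∫ x, expKernel p q.1 x| ≤
        Real.exp (-(p * (T - q.2))) * ∫ x, expKernel p q.1 x := by
      rw [abs_sub_comm, abs_of_nonneg (by linarith)]
      linarith
    rw [h3, ← hcG _ hq.1, show c q.1 * (g q.2 * Real.exp (-(p * q.2))) *
        (∫ t in Ioc 0 T, expKernel p q.1 (t - q.2)) -
        (c q.1 * ∫ x, expKernel p q.1 x) * (g q.2 * Real.exp (-(p * q.2))) =
        c q.1 * (g q.2 * Real.exp (-(p * q.2))) *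
        ((∫ t in Ioc 0 T, expKernel p q.1 (t - q.2)) - ∫ x, expKernel p q.1 x) by ring,
      Real.norm_eq_abs, abs_mul, abs_mul, abs_mul, abs_of_nonneg h5, Real.abs_exp]
    calc _ ≤ c q.1 * (|g q.2| * Real.exp (-(p * q.2))) *
          (Real.exp (-(p * (T - q.2))) * ∫ x, expKernel p q.1 x) := by gcongr
      _ = (c q.1 * ∫ x, expKernel p q.1 x) * |g q.2| *
          (Real.exp (-(p * q.2)) * Real.exp (-(p * (T - q.2)))) := by ring
      _ = p ^ (q.1 - 1) * μ q.1 * |g q.2| * Real.exp (-(p * T)) := by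
          rw [hcG _ hq.1, ← Real.exp_add]; ring_nf
      _ ≤ 1 * μ q.1 * |g q.2| * Real.exp (-(p * T)) := by
          have := hμ0 _ (Ioo_subset_Icc_self hq.1)
          gcongr
          exact hpow _ hq.1
      _ = _ := by rw [one_mul]
  have hparts : ∫ s, g s * Real.exp (-(p * s)) ∂mS =
      y T * Real.exp (-(p * T)) +
        (p * (∫ t in (0 : ℝ)..T, Real.exp (-(p * t)) * y t) - y 0) := by
    have h1 := hy.integral_mul_deriv_eq_deriv_mul (absolutelyContinuousOnInterval_exp p T)
    have h2 : deriv (fun t => Real.exp (-(p * t))) = fun t => -p * Real.exp (-(p * t)) := by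
      funext t
      have := ((hasDerivAt_id' t).const_mul (-p)).exp
      simp only [mul_one, neg_mul] at this
      rw [this.deriv]
      ring
    have h3 : ∫ x in (0 : ℝ)..T, y x * deriv (fun t => Real.exp (-(p * t))) x =
        -p * ∫ t in (0 : ℝ)..T, Real.exp (-(p * t)) * y t := by
      rw [h2, ← intervalIntegral.integral_const_mul]
      refine intervalIntegral.integral_congr fun t _ => ?_
      simp only
      ring
    rw [h3, intervalIntegral.integral_of_le hT.le (f := fun x => deriv y x * _),
      integral_Ioc_eq_integral_Ioo] at h1
    simp only [mul_zero, neg_zero, Real.exp_zero, mul_one] at h1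
    change ∫ s in Ioo 0 T, deriv y s * Real.exp (-(p * s)) = _
    linarith
  refine ⟨?_, ?_⟩
  · rw [intervalIntegrable_iff_integrableOn_Ioc_of_le hT.le]
    exact hfi.integral_prod_right.congr hinner
  · have hM : |symbol μ p / p| ≤ ∫ α, μ α ∂mA := by
      rw [← hwsym]
      rw [← Real.norm_eq_abs]
      refine norm_integral_le_of_norm_le hμi ?_
      filter_upwards [ae_restrict_mem measurableSet_Ioo] with α hα
      have := hμ0 _ (Ioo_subset_Icc_self hα)
      rw [Real.norm_of_nonneg (by positivity)]
      exact mul_le_of_le_one_left this (hpow α hα)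
    rw [intervalIntegral.integral_of_le hT.le (f := fun t => Real.exp (-(p * t)) * distCaputo μ y t),
      ← integral_congr_ae hinner, hswap]
    rw [hparts] at hmain
    set A := p * (∫ t in (0 : ℝ)..T, Real.exp (-(p * t)) * y t) - y 0
    set I := ∫ q, (∫ t, f (q, t) ∂mT) ∂(mA.prod mS)
    have hB : |symbol μ p / p * (y T * Real.exp (-(p * T)))| ≤
        (∫ α, μ α ∂mA) * |y T| * Real.exp (-(p * T)) := by
      rw [abs_mul, abs_mul, Real.abs_exp, ← mul_assoc]
      gcongr
    calc |I - symbol μ p / p * A| = |(I - symbol μ p / p * (y T * Real.exp (-(p * T)) + A)) +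
          symbol μ p / p * (y T * Real.exp (-(p * T)))| := by ring_nf
      _ ≤ _ := abs_add_le _ _
      _ ≤ _ := by rw [add_mul]; exact add_le_add hmain hB


/-! ### The symbol on the strip 0 ≤ Im ζ ≤ π. -/

/-- The symbol in logarithmic coordinates, `W(ζ) = ∫₀¹ exp (α ζ) μ(α) dα`. -/
noncomputable def csymbol (μ : ℝ → ℝ) (ζ : ℂ) : ℂ :=
  ∫ α in (0 : ℝ)..1, Complex.exp (α * ζ) * μ α

theorem intervalIntegrable_weight_mul (hμc : ContinuousOn μ (Icc 0 1)) {E : Type*}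
    [NormedAddCommGroup E] [NormedSpace ℝ E] {f : ℝ → E} (hf : Continuous f) :
    IntervalIntegrable (fun α => μ α • f α) volume 0 1 := by
  refine ContinuousOn.intervalIntegrable ?_
  rw [uIcc_of_le zero_le_one]
  exact hμc.smul hf.continuousOn

theorem intervalIntegrable_csymbol (hμc : ContinuousOn μ (Icc 0 1)) {f : ℝ → ℂ}
    (hf : Continuous f) : IntervalIntegrable (fun α => f α * μ α) volume 0 1 := by
  have := intervalIntegrable_weight_mul hμc hf
  simpa [Complex.real_smul, mul_comm] using this

theorem intervalIntegrable_symbol (hμc : ContinuousOn μ (Icc 0 1)) {f : ℝ → ℝ}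
    (hf : Continuous f) : IntervalIntegrable (fun α => f α * μ α) volume 0 1 := by
  have := intervalIntegrable_weight_mul hμc hf
  simpa [mul_comm] using this

/-- With s = e^ζ the symbol becomes entire: no branch of s^α has to be chosen, and the upper side of
the cut along the negative axis becomes the line Im ζ = π. -/
theorem differentiable_csymbol (hμc : ContinuousOn μ (Icc 0 1)) :
    Differentiable ℂ (csymbol μ) := by
  intro ζ
  have h1 := intervalIntegrable_symbol hμc (f := fun _ => Real.exp (‖ζ‖ + 1)) continuous_const
  refine (intervalIntegral.hasDerivAt_integral_of_dominated_loc_of_deriv_le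
    (F := fun ζ (α : ℝ) => Complex.exp (α * ζ) * μ α)
    (F' := fun ζ (α : ℝ) => Complex.exp (α * ζ) * α * μ α)
    (bound := fun α => ‖Real.exp (‖ζ‖ + 1) * μ α‖)
    (Metric.ball_mem_nhds ζ one_pos) ?_ ?_ ?_ ?_ ?_ ?_).2.differentiableAt
  · refine Eventually.of_forall fun z => ?_
    rw [uIoc_of_le zero_le_one]
    exact (intervalIntegrable_csymbol hμc (by fun_prop)).1.aestronglyMeasurable
  · exact intervalIntegrable_csymbol hμc (by fun_prop)
  · rw [uIoc_of_le zero_le_one]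
    exact (intervalIntegrable_csymbol hμc
      (f := fun α => Complex.exp (α * ζ) * α) (by fun_prop)).1.aestronglyMeasurable
  · refine ae_of_all _ fun α hα z hz => ?_
    rw [uIoc_of_le zero_le_one] at hα
    rw [norm_mul, norm_mul, norm_mul, Complex.norm_exp, Complex.norm_real, Complex.norm_real,
      Real.norm_of_nonneg hα.1.le, Real.norm_of_nonneg (Real.exp_pos _).le]
    refine mul_le_mul_of_nonneg_right ?_ (norm_nonneg _)
    refine (mul_le_of_le_one_right (Real.exp_pos _).le hα.2).trans (Real.exp_le_exp.2 ?_)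
    calc ((α : ℂ) * z).re ≤ ‖(α : ℂ) * z‖ := Complex.re_le_norm _
      _ = α * ‖z‖ := by rw [norm_mul, Complex.norm_real, Real.norm_of_nonneg hα.1.le]
      _ ≤ 1 * ‖z‖ := by gcongr; exact hα.2
      _ ≤ ‖ζ‖ + 1 := by
        have h2 := norm_le_norm_add_norm_sub ζ z
        rw [← dist_eq_norm, dist_comm] at h2
        have := Metric.mem_ball.1 hz
        linarith
  · exact h1.norm
  · refine ae_of_all _ fun α _ z _ => ?_
    have := ((hasDerivAt_id' z).const_mul (α : ℂ)).cexp
    simpa using this.mul_const (μ α : ℂ)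

theorem csymbol_ofReal (x : ℝ) : csymbol μ x = (symbol μ (Real.exp x) : ℂ) := by
  rw [csymbol, symbol, ← intervalIntegral.integral_ofReal]
  refine intervalIntegral.integral_congr fun α _ => ?_
  rw [← Real.exp_mul]
  push_cast
  rw [mul_comm (x : ℂ)]

theorem csymbol_im (hμc : ContinuousOn μ (Icc 0 1)) (ζ : ℂ) :
    (csymbol μ ζ).im = ∫ α in (0 : ℝ)..1, Real.exp (α * ζ.re) * Real.sin (α * ζ.im) * μ α := by
  have h := Complex.imCLM.intervalIntegral_comp_comm
    (intervalIntegrable_csymbol hμc (f := fun α => Complex.exp (α * ζ)) (by fun_prop))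
  rw [csymbol, ← Complex.imCLM_apply, ← h]
  refine intervalIntegral.integral_congr fun α _ => ?_
  simp [Complex.exp_im]

theorem csymbol_re (hμc : ContinuousOn μ (Icc 0 1)) (ζ : ℂ) :
    (csymbol μ ζ).re = ∫ α in (0 : ℝ)..1, Real.exp (α * ζ.re) * Real.cos (α * ζ.im) * μ α := by
  have h := Complex.reCLM.intervalIntegral_comp_comm
    (intervalIntegrable_csymbol hμc (f := fun α => Complex.exp (α * ζ)) (by fun_prop))
  rw [csymbol, ← Complex.reCLM_apply, ← h]
  refine intervalIntegral.integral_congr fun α _ => ?_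
  simp [Complex.exp_re]

theorem norm_csymbol_le (hμ0 : ∀ α ∈ Icc (0 : ℝ) 1, 0 ≤ μ α) (ζ : ℂ) :
    ‖csymbol μ ζ‖ ≤ symbol μ (Real.exp ζ.re) := by
  refine (intervalIntegral.norm_integral_le_integral_norm zero_le_one).trans_eq ?_
  refine intervalIntegral.integral_congr fun α hα => ?_
  rw [uIcc_of_le zero_le_one] at hα
  rw [norm_mul, Complex.norm_exp, Complex.norm_real, Real.norm_of_nonneg (hμ0 α hα),
    ← Real.exp_mul]
  simp [mul_comm]

/-- An interior point is needed because weights such as sin(αθ) vanish at α = 0. -/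
theorem exists_weight_pos (hμc : ContinuousOn μ (Icc 0 1)) (hμp : 0 < μ 0) :
    ∃ c ∈ Ioo (0 : ℝ) 1, 0 < μ c := by
  have h1 : ContinuousWithinAt μ (Ioo 0 1) 0 :=
    (hμc 0 (left_mem_Icc.2 zero_le_one)).mono Ioo_subset_Icc_self
  have h2 := h1.eventually (lt_mem_nhds hμp)
  have h3 : (𝓝[Ioo (0 : ℝ) 1] 0).NeBot := by
    rw [nhdsWithin_Ioo_eq_nhdsGT zero_lt_one]
    infer_instance
  obtain ⟨c, hc⟩ := (h2.and self_mem_nhdsWithin).exists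
  exact ⟨c, hc.2, hc.1⟩

theorem integral_weight_pos (hμc : ContinuousOn μ (Icc 0 1))
    (hμ0 : ∀ α ∈ Icc (0 : ℝ) 1, 0 ≤ μ α) (hμp : 0 < μ 0) {f : ℝ → ℝ} (hf : Continuous f)
    (hf0 : ∀ α ∈ Icc (0 : ℝ) 1, 0 ≤ f α) (hfp : ∀ α ∈ Ioo (0 : ℝ) 1, 0 < f α) :
    0 < ∫ α in (0 : ℝ)..1, f α * μ α := by
  obtain ⟨c, hc, hcp⟩ := exists_weight_pos hμc hμp
  refine intervalIntegral.integral_pos zero_lt_one (hf.continuousOn.mul hμc) (fun α hα => ?_)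
    ⟨c, Ioo_subset_Icc_self hc, mul_pos (hfp c hc) hcp⟩
  exact mul_nonneg (hf0 α (Ioc_subset_Icc_self hα)) (hμ0 α (Ioc_subset_Icc_self hα))

theorem symbol_pos (hμc : ContinuousOn μ (Icc 0 1)) (hμ0 : ∀ α ∈ Icc (0 : ℝ) 1, 0 ≤ μ α)
    (hμp : 0 < μ 0) {s : ℝ} (hs : 0 < s) : 0 < symbol μ s :=
  integral_weight_pos hμc hμ0 hμp (Real.continuous_const_rpow hs.ne')
    (fun _ _ => (Real.rpow_pos_of_pos hs _).le) fun _ _ => Real.rpow_pos_of_pos hs _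

/-- All orders pull in the same direction: sin(α Im ζ) > 0 for 0 < α < 1. This excludes poles of the
transfer function and makes the Stieltjes density nonnegative. -/
theorem csymbol_im_pos (hμc : ContinuousOn μ (Icc 0 1)) (hμ0 : ∀ α ∈ Icc (0 : ℝ) 1, 0 ≤ μ α)
    (hμp : 0 < μ 0) {ζ : ℂ} (h0 : 0 < ζ.im) (hπ : ζ.im ≤ Real.pi) : 0 < (csymbol μ ζ).im := by
  rw [csymbol_im hμc]
  refine integral_weight_pos hμc hμ0 hμp (by fun_prop) (fun α hα => ?_) fun α hα => ?_
  · refine mul_nonneg (Real.exp_pos _).le (Real.sin_nonneg_of_nonneg_of_le_pi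
      (mul_nonneg hα.1 h0.le) ?_)
    nlinarith [hα.1, hα.2]
  · refine mul_pos (Real.exp_pos _) (Real.sin_pos_of_pos_of_lt_pi (mul_pos hα.1 h0) ?_)
    nlinarith [hα.1, hα.2]

theorem csymbol_add_ne_zero (hμc : ContinuousOn μ (Icc 0 1))
    (hμ0 : ∀ α ∈ Icc (0 : ℝ) 1, 0 ≤ μ α) (hμp : 0 < μ 0) {lam : ℝ} (hlam : 0 ≤ lam) {ζ : ℂ}
    (h0 : 0 ≤ ζ.im) (hπ : ζ.im ≤ Real.pi) : csymbol μ ζ + lam ≠ 0 := by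
  intro h
  rcases h0.eq_or_lt with h1 | h1
  · have h2 : ζ = (ζ.re : ℂ) := Complex.ext rfl (by simp [← h1])
    rw [h2, csymbol_ofReal] at h
    have h3 := symbol_pos hμc hμ0 hμp (Real.exp_pos ζ.re)
    have h4 : symbol μ (Real.exp ζ.re) + lam = 0 := by exact_mod_cast h
    linarith
  · have h2 := csymbol_im_pos hμc hμ0 hμp h1 hπ
    have h3 := congrArg Complex.im h
    simp at h3
    linarith

/-- In the right part of the strip `0 ≤ Im ζ ≤ π` the quantity `W + lam` stays away from zero. -/
theorem exists_le_norm_csymbol_add (hμc : ContinuousOn μ (Icc 0 1))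
    (hμ0 : ∀ α ∈ Icc (0 : ℝ) 1, 0 ≤ μ α) (hμp : 0 < μ 0) {lam : ℝ} (hlam : 0 < lam) :
    ∃ c > 0, ∀ ζ : ℂ, 0 ≤ ζ.re → 0 ≤ ζ.im → ζ.im ≤ Real.pi → c ≤ ‖csymbol μ ζ + lam‖ := by
  have hcont : ContinuousOn (fun θ : ℝ => (csymbol μ (θ * Complex.I)).im)
      (Icc (Real.pi / 2) Real.pi) :=
    (Complex.continuous_im.comp ((differentiable_csymbol hμc).continuous.comp
      (by fun_prop))).continuousOn
  have hpi := Real.pi_pos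
  obtain ⟨θ₀, hθ₀, hmin⟩ := isCompact_Icc.exists_isMinOn
    (nonempty_Icc.2 (by linarith : Real.pi / 2 ≤ Real.pi)) hcont
  have hc₀ : 0 < (csymbol μ (θ₀ * Complex.I)).im :=
    csymbol_im_pos hμc hμ0 hμp (by simp; linarith [hθ₀.1]) (by simpa using hθ₀.2)
  refine ⟨min lam (csymbol μ (θ₀ * Complex.I)).im, lt_min hlam hc₀, fun ζ hre him hπ => ?_⟩
  -- In the lower half of the strip cos(α Im ζ) ≥ 0, so the real part is at least `lam`. In the
  -- upper half Im W does not decrease with Re ζ, so its minimum over the compact segment Re ζ = 0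
  -- is a lower bound.
  rcases le_total ζ.im (Real.pi / 2) with h | h
  · refine (min_le_left _ _).trans ?_
    have h1 : 0 ≤ (csymbol μ ζ).re := by
      rw [csymbol_re hμc]
      refine intervalIntegral.integral_nonneg zero_le_one fun α hα => ?_
      refine mul_nonneg (mul_nonneg (Real.exp_pos _).le
        (Real.cos_nonneg_of_neg_pi_div_two_le_of_le ?_ ?_)) (hμ0 α hα)
      · nlinarith [hα.1, mul_nonneg hα.1 him]
      · nlinarith [hα.1, hα.2]
    refine le_trans ?_ (Complex.re_le_norm _)
    simpa using h1
  · refine (min_le_right _ _).trans ?_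
    refine (hmin (⟨h, hπ⟩ : ζ.im ∈ Icc (Real.pi / 2) Real.pi)).trans ?_
    refine le_trans ?_ ((le_abs_self _).trans (Complex.abs_im_le_norm _))
    beta_reduce
    rw [Complex.add_im, Complex.ofReal_im, add_zero, csymbol_im hμc, csymbol_im hμc]
    refine intervalIntegral.integral_mono_on zero_le_one
      (intervalIntegrable_symbol hμc (by fun_prop)) (intervalIntegrable_symbol hμc (by fun_prop))
      fun α hα => ?_
    have h2 : 0 ≤ Real.sin (α * ζ.im) := Real.sin_nonneg_of_nonneg_of_le_pi
      (mul_nonneg hα.1 him) (by nlinarith [hα.1, hα.2])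
    have h3 : 1 ≤ Real.exp (α * ζ.re) := Real.one_le_exp (mul_nonneg hα.1 hre)
    have h4 := hμ0 α hα
    simp only [Complex.mul_re, Complex.mul_im, Complex.ofReal_re, Complex.ofReal_im,
      Complex.I_re, Complex.I_im, mul_zero, mul_one, sub_zero, Real.exp_zero, one_mul,
      add_zero]
    exact mul_le_mul_of_nonneg_right (le_mul_of_one_le_left h2 h3) h4

/-- Dominated convergence, since s^α → 0 as s → 0 for every α > 0. It makes the transfer function
vanish on the left edge of the contour. -/
theorem tendsto_symbol_exp_atBot (hμc : ContinuousOn μ (Icc 0 1)) :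
    Tendsto (fun R => symbol μ (Real.exp (-R))) atTop (𝓝 0) := by
  have h0 : (0 : ℝ) = ∫ _α in (0 : ℝ)..1, (0 : ℝ) := by simp
  rw [h0]
  refine intervalIntegral.tendsto_integral_filter_of_dominated_convergence (fun α => ‖μ α‖)
    (Eventually.of_forall fun R => ?_) ?_ ?_ ?_
  · rw [uIoc_of_le zero_le_one]
    exact (intervalIntegrable_symbol hμc
      (Real.continuous_const_rpow (Real.exp_pos _).ne')).1.aestronglyMeasurable
  · filter_upwards [eventually_ge_atTop 0] with R hR
    refine ae_of_all _ fun α hα => ?_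
    rw [uIoc_of_le zero_le_one] at hα
    rw [norm_mul, ← Real.exp_mul, Real.norm_of_nonneg (Real.exp_pos _).le]
    refine mul_le_of_le_one_left (norm_nonneg _) (Real.exp_le_one_iff.2 ?_)
    nlinarith [hα.1, mul_nonneg hR hα.1.le]
  · refine ContinuousOn.intervalIntegrable ?_
    rw [uIcc_of_le zero_le_one]
    exact hμc.norm
  · refine ae_of_all _ fun α hα => ?_
    rw [uIoc_of_le zero_le_one] at hα
    have h1 : Tendsto (fun R : ℝ => R * α) atTop atTop := tendsto_id.atTop_mul_const hα.1
    have h2 := (Real.tendsto_exp_neg_atTop_nhds_zero.comp h1).mul_const (μ α)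
    rw [zero_mul] at h2
    refine h2.congr fun R => ?_
    simp only [Function.comp]
    rw [← Real.exp_mul, neg_mul]


/-! ### Cauchy's theorem and the Stieltjes representation. -/

/-- The transfer function `W / (W + lam)` in logarithmic coordinates. -/
noncomputable def transfer (μ : ℝ → ℝ) (lam : ℝ) (ζ : ℂ) : ℂ :=
  csymbol μ ζ / (csymbol μ ζ + lam)

/-- The transfer function times the Cauchy kernel, with the pole at `σ` removed. -/
noncomputable def regKernel (μ : ℝ → ℝ) (lam σ : ℝ) (ζ : ℂ) : ℂ :=
  dslope (transfer μ lam) σ ζ * (-Real.exp σ : ℂ) / dslope Complex.exp σ ζ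

theorem exp_ne_of_ne {σ : ℝ} {ζ : ℂ} (h : ζ ≠ σ) (h0 : 0 ≤ ζ.im) (hπ : ζ.im ≤ Real.pi) :
    Complex.exp ζ ≠ Complex.exp σ := by
  intro he
  refine h (Complex.exp_inj_of_neg_pi_lt_of_le_pi ?_ hπ ?_ ?_ he)
  · linarith [Real.pi_pos]
  · simpa using Real.pi_pos
  · simpa using Real.pi_pos.le

/-- The two difference quotients share the denominator ζ - σ, which cancels. The `dslope` form stays
continuous at σ, a point of the real axis and hence of the line carrying the bottom edge, so the
contour needs no indentation. -/
theorem regKernel_of_ne {lam σ : ℝ} {ζ : ℂ} (h : ζ ≠ σ) (h0 : 0 ≤ ζ.im) (hπ : ζ.im ≤ Real.pi) :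
    regKernel μ lam σ ζ =
      (transfer μ lam ζ - transfer μ lam σ) * (Real.exp σ / (Real.exp σ - Complex.exp ζ)) := by
  have h1 : ζ - σ ≠ 0 := sub_ne_zero.2 h
  have h2 : Complex.exp ζ - Complex.exp σ ≠ 0 := sub_ne_zero.2 (exp_ne_of_ne h h0 hπ)
  have h3 : Complex.exp σ - Complex.exp ζ ≠ 0 := sub_ne_zero.2 (exp_ne_of_ne h h0 hπ).symm
  rw [regKernel, dslope_of_ne _ h, dslope_of_ne _ h, slope_def_field, slope_def_field,
    Complex.ofReal_exp]
  field_simp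
  ring

theorem differentiableAt_transfer (hμc : ContinuousOn μ (Icc 0 1))
    (hμ0 : ∀ α ∈ Icc (0 : ℝ) 1, 0 ≤ μ α) (hμp : 0 < μ 0) {lam : ℝ} (hlam : 0 < lam) {ζ : ℂ}
    (h0 : 0 ≤ ζ.im) (hπ : ζ.im ≤ Real.pi) : DifferentiableAt ℂ (transfer μ lam) ζ :=
  (differentiable_csymbol hμc ζ).div ((differentiable_csymbol hμc ζ).add_const _)
    (csymbol_add_ne_zero hμc hμ0 hμp hlam.le h0 hπ)

theorem transfer_ofReal (lam x : ℝ) : transfer μ lam x =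
    ((symbol μ (Real.exp x) / (symbol μ (Real.exp x) + lam) : ℝ) : ℂ) := by
  rw [transfer, csymbol_ofReal]
  push_cast
  rfl

theorem transfer_im (lam : ℝ) (ζ : ℂ) :
    (transfer μ lam ζ).im =
      lam * (csymbol μ ζ).im / Complex.normSq (csymbol μ ζ + lam) := by
  rw [transfer, Complex.div_im]
  simp only [Complex.add_re, Complex.add_im, Complex.ofReal_re, Complex.ofReal_im]
  ring

theorem continuousAt_regKernel (hμc : ContinuousOn μ (Icc 0 1))
    (hμ0 : ∀ α ∈ Icc (0 : ℝ) 1, 0 ≤ μ α) (hμp : 0 < μ 0) {lam : ℝ} (hlam : 0 < lam) (σ : ℝ)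
    {ζ : ℂ} (h0 : 0 ≤ ζ.im) (hπ : ζ.im ≤ Real.pi) : ContinuousAt (regKernel μ lam σ) ζ := by
  have hexp : ∀ z : ℂ, DifferentiableAt ℂ Complex.exp z := fun z =>
    Complex.differentiable_exp z
  rcases eq_or_ne ζ σ with rfl | h
  · refine ContinuousAt.div (ContinuousAt.mul (continuousAt_dslope_same.2
      (differentiableAt_transfer hμc hμ0 hμp hlam h0 hπ)) continuousAt_const)
      (continuousAt_dslope_same.2 (hexp _)) ?_
    rw [dslope_same, Complex.deriv_exp]
    exact Complex.exp_ne_zero _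
  · refine ContinuousAt.div (ContinuousAt.mul ((continuousAt_dslope_of_ne h).2
      (differentiableAt_transfer hμc hμ0 hμp hlam h0 hπ).continuousAt) continuousAt_const)
      ((continuousAt_dslope_of_ne h).2 (hexp _).continuousAt) ?_
    rw [dslope_of_ne _ h, slope_def_field]
    exact div_ne_zero (sub_ne_zero.2 (exp_ne_of_ne h h0 hπ)) (sub_ne_zero.2 h)

theorem differentiableAt_regKernel (hμc : ContinuousOn μ (Icc 0 1))
    (hμ0 : ∀ α ∈ Icc (0 : ℝ) 1, 0 ≤ μ α) (hμp : 0 < μ 0) {lam : ℝ} (hlam : 0 < lam) (σ : ℝ)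
    {ζ : ℂ} (h0 : 0 < ζ.im) (hπ : ζ.im ≤ Real.pi) :
    DifferentiableAt ℂ (regKernel μ lam σ) ζ := by
  have h : ζ ≠ σ := fun h => by simp [h] at h0
  refine DifferentiableAt.div (DifferentiableAt.mul ((differentiableAt_dslope_of_ne h).2
    (differentiableAt_transfer hμc hμ0 hμp hlam h0.le hπ)) (differentiableAt_const _))
    ((differentiableAt_dslope_of_ne h).2 (Complex.differentiable_exp ζ)) ?_
  rw [dslope_of_ne _ h, slope_def_field]
  exact div_ne_zero (sub_ne_zero.2 (exp_ne_of_ne h h0.le hπ)) (sub_ne_zero.2 h)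

/-- Cauchy's theorem on the rectangle `[-R, R] × [0, π]`, imaginary part. -/
theorem integral_transfer_im_eq (hμc : ContinuousOn μ (Icc 0 1))
    (hμ0 : ∀ α ∈ Icc (0 : ℝ) 1, 0 ≤ μ α) (hμp : 0 < μ 0) {lam : ℝ} (hlam : 0 < lam) (σ R : ℝ) :
    ∫ x in (-R)..R, (transfer μ lam (x + Real.pi * Complex.I)).im *
        (Real.exp σ / (Real.exp σ + Real.exp x)) =
      (∫ y in (0 : ℝ)..Real.pi, regKernel μ lam σ (R + y * Complex.I)).re -
        (∫ y in (0 : ℝ)..Real.pi, regKernel μ lam σ (-R + y * Complex.I)).re := by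
  have hpi := Real.pi_pos
  have hC := Complex.integral_boundary_rect_eq_zero_of_continuousOn_of_differentiableOn
    (regKernel μ lam σ) ⟨-R, 0⟩ ⟨R, Real.pi⟩
    (fun ζ hζ => by
      have h2 := hζ.2
      simp only [mem_preimage, uIcc_of_le hpi.le] at h2
      exact (continuousAt_regKernel hμc hμ0 hμp hlam σ h2.1 h2.2).continuousWithinAt)
    (fun ζ hζ => by
      have h2 := hζ.2
      simp only [mem_preimage, min_eq_left hpi.le, max_eq_right hpi.le] at h2
      exact (differentiableAt_regKernel hμc hμ0 hμp hlam σ h2.1 h2.2.le).differentiableWithinAt)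
  simp only [Complex.ofReal_zero, zero_mul, add_zero, smul_eq_mul] at hC
  -- Every factor is real on the real axis; the single point x = σ is null.
  have hbot : (∫ x in (-R)..R, regKernel μ lam σ x).im = 0 := by
    have h1 : ∫ x in (-R)..R, regKernel μ lam σ x = ∫ x in (-R)..R,
        (((symbol μ (Real.exp x) / (symbol μ (Real.exp x) + lam) -
          symbol μ (Real.exp σ) / (symbol μ (Real.exp σ) + lam)) *
            (Real.exp σ / (Real.exp σ - Real.exp x)) : ℝ) : ℂ) := by
      refine intervalIntegral.integral_congr_ae ?_
      filter_upwards [measure_eq_zero_iff_ae_notMem.1 (measure_singleton σ :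
          volume {σ} = 0)] with x hx _
      have hx' : (x : ℂ) ≠ σ := fun h => hx (by simpa using h)
      rw [regKernel_of_ne hx' (by simp) (by simpa using hpi.le), transfer_ofReal, transfer_ofReal]
      push_cast
      rfl
    rw [h1, intervalIntegral.integral_ofReal, Complex.ofReal_im]
  -- On the top edge e^ζ = -e^x, so the Cauchy kernel is real and positive, and the subtracted value
  -- at σ is real and drops out of the imaginary part.
  have htop : (∫ x in (-R)..R, regKernel μ lam σ (x + Real.pi * Complex.I)).im =
      ∫ x in (-R)..R, (transfer μ lam (x + Real.pi * Complex.I)).im *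
        (Real.exp σ / (Real.exp σ + Real.exp x)) := by
    have hint : IntervalIntegrable (fun x : ℝ => regKernel μ lam σ (x + Real.pi * Complex.I))
        volume (-R) R := by
      refine Continuous.intervalIntegrable (continuous_iff_continuousAt.2 fun x => ?_) _ _
      exact ContinuousAt.comp (g := regKernel μ lam σ)
        (f := fun x : ℝ => (x : ℂ) + Real.pi * Complex.I)
        (continuousAt_regKernel hμc hμ0 hμp hlam σ (by simpa using hpi.le) (by simp))
        (by fun_prop)
    rw [← Complex.imCLM_apply, ← Complex.imCLM.intervalIntegral_comp_comm hint]
    refine intervalIntegral.integral_congr fun x _ => ?_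
    have hne : (x : ℂ) + Real.pi * Complex.I ≠ σ := fun h => by
      have := congrArg Complex.im h
      simp [Real.pi_ne_zero] at this
    have hexp : (Real.exp σ : ℂ) / (Real.exp σ - Complex.exp (x + Real.pi * Complex.I)) =
        ((Real.exp σ / (Real.exp σ + Real.exp x) : ℝ) : ℂ) := by
      rw [Complex.exp_add, Complex.exp_pi_mul_I]
      push_cast
      ring
    simp only [Complex.imCLM_apply]
    rw [regKernel_of_ne hne (by simpa using hpi.le) (by simp), hexp, Complex.im_mul_ofReal,
      Complex.sub_im, transfer_ofReal lam σ, Complex.ofReal_im, sub_zero]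
  have him := congrArg Complex.im hC
  simp only [Complex.sub_im, Complex.add_im, Complex.I_mul_im, Complex.zero_im, hbot, htop,
    Complex.ofReal_neg] at him
  linarith

/-- The transfer function equals 1 - λ/(W+λ) and is bounded on the right, while the Cauchy kernel
decays like e^{-R}. -/
theorem tendsto_integral_regKernel_right (hμc : ContinuousOn μ (Icc 0 1))
    (hμ0 : ∀ α ∈ Icc (0 : ℝ) 1, 0 ≤ μ α) (hμp : 0 < μ 0) {lam : ℝ} (hlam : 0 < lam) (σ : ℝ) :
    Tendsto (fun R : ℝ => ∫ y in (0 : ℝ)..Real.pi, regKernel μ lam σ (R + y * Complex.I))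
      atTop (𝓝 0) := by
  have hpi := Real.pi_pos
  obtain ⟨c, hc, hcle⟩ := exists_le_norm_csymbol_add hμc hμ0 hμp hlam
  have hlim : Tendsto (fun R : ℝ => (1 + lam / c + ‖transfer μ lam σ‖) *
      (Real.exp σ / (Real.exp R - Real.exp σ)) * |Real.pi - 0|) atTop (𝓝 0) := by
    have h1 : Tendsto (fun R : ℝ => Real.exp R - Real.exp σ) atTop atTop :=
      tendsto_atTop_add_const_right _ _ Real.tendsto_exp_atTop
    simpa using ((h1.const_div_atTop (Real.exp σ)).const_mul
      (1 + lam / c + ‖transfer μ lam σ‖)).mul_const |Real.pi - 0|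
  refine squeeze_zero_norm' ?_ hlim
  filter_upwards [eventually_ge_atTop 0, eventually_gt_atTop σ] with R hR hRσ
  refine intervalIntegral.norm_integral_le_of_norm_le_const fun y hy => ?_
  rw [uIoc_of_le hpi.le] at hy
  set ζ : ℂ := R + y * Complex.I with hζ
  have hre : ζ.re = R := by simp [hζ]
  have him : ζ.im = y := by simp [hζ]
  have hne : ζ ≠ σ := fun h => by
    have := congrArg Complex.re h
    rw [hre, Complex.ofReal_re] at this
    linarith
  have h0 : 0 ≤ ζ.im := him ▸ hy.1.le
  have hle : ζ.im ≤ Real.pi := him ▸ hy.2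
  have hW := csymbol_add_ne_zero hμc hμ0 hμp hlam.le h0 hle
  have htr : ‖transfer μ lam ζ‖ ≤ 1 + lam / c := by
    have h1 : transfer μ lam ζ = 1 - lam / (csymbol μ ζ + lam) := by
      rw [transfer, eq_sub_iff_add_eq, ← add_div, div_self hW]
    rw [h1]
    refine (norm_sub_le _ _).trans ?_
    rw [norm_one, norm_div, Complex.norm_real, Real.norm_of_nonneg hlam.le]
    gcongr
    exact hcle ζ (hre ▸ hR) h0 hle
  have hσR : 0 < Real.exp R - Real.exp σ := sub_pos.2 (Real.exp_lt_exp.2 hRσ)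
  have hk : ‖(Real.exp σ : ℂ) / (Real.exp σ - Complex.exp ζ)‖ ≤
      Real.exp σ / (Real.exp R - Real.exp σ) := by
    rw [norm_div, Complex.norm_real, Real.norm_of_nonneg (Real.exp_pos _).le]
    gcongr
    have h1 := norm_sub_norm_le (Complex.exp ζ) (Real.exp σ : ℂ)
    rw [Complex.norm_exp, Complex.norm_real, Real.norm_of_nonneg (Real.exp_pos _).le, hre,
      norm_sub_rev] at h1
    exact h1
  rw [regKernel_of_ne hne h0 hle, norm_mul]
  gcongr
  exact (norm_sub_le _ _).trans (by gcongr)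

/-- Both W and e^ζ tend to 0 on the left edge, so the kernel tends to 1 and only the subtracted
value at σ survives, over an edge of length π. -/
theorem tendsto_integral_regKernel_left (hμc : ContinuousOn μ (Icc 0 1))
    (hμ0 : ∀ α ∈ Icc (0 : ℝ) 1, 0 ≤ μ α) (hμp : 0 < μ 0) {lam : ℝ} (hlam : 0 < lam) (σ : ℝ) :
    Tendsto (fun R : ℝ => ∫ y in (0 : ℝ)..Real.pi, regKernel μ lam σ (-R + y * Complex.I))
      atTop (𝓝 (-(Real.pi * transfer μ lam σ))) := by
  have hpi := Real.pi_pos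
  have hval : -(Real.pi * transfer μ lam σ) =
      ∫ _y in (0 : ℝ)..Real.pi, -transfer μ lam σ := by
    simp
  have hWlim := tendsto_symbol_exp_atBot hμc
  have hElim : Tendsto (fun R : ℝ => Real.exp (-R)) atTop (𝓝 0) :=
    Real.tendsto_exp_neg_atTop_nhds_zero
  have hσ := Real.exp_pos σ
  rw [hval]
  refine intervalIntegral.tendsto_integral_filter_of_dominated_convergence
    (fun _ => (1 + ‖transfer μ lam σ‖) * 2) (Eventually.of_forall fun R => ?_) ?_
    intervalIntegrable_const ?_
  · refine ContinuousOn.aestronglyMeasurable (fun y hy => ?_) measurableSet_uIoc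
    rw [uIoc_of_le hpi.le] at hy
    refine ContinuousAt.continuousWithinAt (ContinuousAt.comp (g := regKernel μ lam σ)
      (f := fun y : ℝ => -(R : ℂ) + y * Complex.I)
      (continuousAt_regKernel hμc hμ0 hμp hlam σ ?_ ?_) (by fun_prop))
    · simpa using hy.1.le
    · simpa using hy.2
  · filter_upwards [eventually_gt_atTop (-σ), hWlim.eventually (ge_mem_nhds (half_pos hlam)),
      hElim.eventually (ge_mem_nhds (half_pos hσ))] with R hRσ hRW hRE
    refine ae_of_all _ fun y hy => ?_
    rw [uIoc_of_le hpi.le] at hy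
    set ζ : ℂ := -R + y * Complex.I with hζ
    have hre : ζ.re = -R := by simp [hζ]
    have him : ζ.im = y := by simp [hζ]
    have hne : ζ ≠ σ := fun h => by
      have := congrArg Complex.re h
      rw [hre, Complex.ofReal_re] at this
      linarith
    have h0 : 0 ≤ ζ.im := him ▸ hy.1.le
    have hle : ζ.im ≤ Real.pi := him ▸ hy.2
    have hW : ‖csymbol μ ζ‖ ≤ lam / 2 := (norm_csymbol_le hμ0 ζ).trans (hre ▸ hRW)
    have htr : ‖transfer μ lam ζ‖ ≤ 1 := by
      have h1 := norm_sub_norm_le (lam : ℂ) (-csymbol μ ζ)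
      rw [Complex.norm_real, Real.norm_of_nonneg hlam.le, norm_neg, sub_neg_eq_add,
        add_comm] at h1
      rw [transfer, norm_div]
      exact div_le_one_of_le₀ (by linarith) (norm_nonneg _)
    have hk : ‖(Real.exp σ : ℂ) / (Real.exp σ - Complex.exp ζ)‖ ≤ 2 := by
      have h1 := norm_sub_norm_le (Real.exp σ : ℂ) (Complex.exp ζ)
      rw [Complex.norm_exp, Complex.norm_real, Real.norm_of_nonneg hσ.le, hre] at h1
      rw [norm_div, Complex.norm_real, Real.norm_of_nonneg hσ.le, div_le_iff₀ (by linarith)]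
      linarith
    rw [regKernel_of_ne hne h0 hle, norm_mul]
    gcongr
    exact (norm_sub_le _ _).trans (by gcongr)
  · refine ae_of_all _ fun y hy => ?_
    rw [uIoc_of_le hpi.le] at hy
    have hW : Tendsto (fun R : ℝ => csymbol μ (-R + y * Complex.I)) atTop (𝓝 0) := by
      refine squeeze_zero_norm (fun R => ?_) hWlim
      simpa using norm_csymbol_le hμ0 (-(R : ℂ) + y * Complex.I)
    have hE : Tendsto (fun R : ℝ => Complex.exp (-R + y * Complex.I)) atTop (𝓝 0) := by
      refine squeeze_zero_norm (fun R => ?_) hElim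
      simp [Complex.norm_exp]
    have hΦ : Tendsto (fun R : ℝ => transfer μ lam (-R + y * Complex.I)) atTop (𝓝 0) := by
      have := hW.div (hW.add_const (lam : ℂ)) (by simpa using hlam.ne')
      rw [zero_div] at this
      exact this
    have hσ' : (Real.exp σ : ℂ) ≠ 0 := by exact_mod_cast hσ.ne'
    have hK : Tendsto (fun R : ℝ =>
        (Real.exp σ : ℂ) / (Real.exp σ - Complex.exp (-R + y * Complex.I))) atTop (𝓝 1) := by
      have := (tendsto_const_nhds (x := (Real.exp σ : ℂ))).div
        (hE.const_sub (Real.exp σ : ℂ)) (by simp)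
      rwa [sub_zero, div_self hσ'] at this
    have hlim := (hΦ.sub_const (transfer μ lam σ)).mul hK
    rw [zero_sub, mul_one] at hlim
    refine hlim.congr' ?_
    filter_upwards [eventually_gt_atTop (-σ)] with R hRσ
    refine (regKernel_of_ne (fun h => ?_) ?_ ?_).symm
    · have := congrArg Complex.re h
      simp at this
      linarith
    · simpa using hy.1.le
    · simpa using hy.2

/-- The transfer function as a principal value Stieltjes integral over the branch cut. -/
theorem tendsto_integral_transfer_im (hμc : ContinuousOn μ (Icc 0 1))
    (hμ0 : ∀ α ∈ Icc (0 : ℝ) 1, 0 ≤ μ α) (hμp : 0 < μ 0) {lam : ℝ} (hlam : 0 < lam) (σ : ℝ) :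
    Tendsto (fun R : ℝ => ∫ x in (-R)..R, (transfer μ lam (x + Real.pi * Complex.I)).im *
        (Real.exp σ / (Real.exp σ + Real.exp x))) atTop
      (𝓝 (Real.pi * (symbol μ (Real.exp σ) / (symbol μ (Real.exp σ) + lam)))) := by
  have h1 := (Complex.continuous_re.tendsto _).comp
    (tendsto_integral_regKernel_right hμc hμ0 hμp hlam σ)
  have h2 := (Complex.continuous_re.tendsto _).comp
    (tendsto_integral_regKernel_left hμc hμ0 hμp hlam σ)
  have h3 := h1.sub h2
  rw [transfer_ofReal, Complex.zero_re, Complex.neg_re, zero_sub, neg_neg, ← Complex.ofReal_mul,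
    Complex.ofReal_re] at h3
  refine h3.congr fun R => ?_
  exact (integral_transfer_im_eq hμc hμ0 hμp hlam σ R).symm

/-- The solution operator is a mixture of decaying exponentials: `w(s) / (s (w(s) + lam))` is the
Stieltjes transform of a sub-probability measure on the half line. -/
theorem exists_stieltjes_measure (hμc : ContinuousOn μ (Icc 0 1))
    (hμ0 : ∀ α ∈ Icc (0 : ℝ) 1, 0 ≤ μ α) (hμp : 0 < μ 0) {lam : ℝ} (hlam : 0 ≤ lam) :
    ∃ ν : Measure ℝ, ν univ ≤ 1 ∧ (∀ᵐ r ∂ν, 0 ≤ r) ∧ ∀ s : ℝ, 0 < s →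
      ∫ r, (s + r)⁻¹ ∂ν = symbol μ s / (s * (symbol μ s + lam)) := by
  -- For λ = 0 the transform is 1/s, that of the unit mass at 0.
  rcases hlam.eq_or_lt with rfl | hlam
  · refine ⟨Measure.dirac 0, by simp, ?_, fun s hs => ?_⟩
    · rw [ae_dirac_eq]
      exact le_refl (0 : ℝ)
    · have := (symbol_pos hμc hμ0 hμp hs).ne'
      rw [integral_dirac, add_zero, add_zero, mul_comm, ← div_div, div_self this, one_div]
  have hpi := Real.pi_pos
  -- The boundary value on the upper side of the cut, at s = -e^x; up to the factor π it is the
  -- density of the measure in the variable x = log r.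
  set ρ : ℝ → ℝ := fun x => (transfer μ lam (x + Real.pi * Complex.I)).im with hρ
  have hρ0 : ∀ x, 0 ≤ ρ x := fun x => by
    simp only [hρ]
    rw [transfer_im]
    refine div_nonneg (mul_nonneg hlam.le (csymbol_im_pos hμc hμ0 hμp ?_ ?_).le)
      (Complex.normSq_nonneg _)
    · simpa using hpi
    · simp
  have hρc : Continuous ρ := by
    refine Complex.continuous_im.comp (continuous_iff_continuousAt.2 fun x => ?_)
    exact ContinuousAt.comp (g := transfer μ lam) (f := fun x : ℝ => (x : ℂ) + Real.pi * Complex.I)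
      (differentiableAt_transfer hμc hμ0 hμp hlam (by simpa using hpi.le) (by simp)).continuousAt
      (by fun_prop)
  have hcov : AECover (volume : Measure ℝ) atTop fun R : ℝ => Ioc (-R) R :=
    aecover_Ioc tendsto_neg_atTop_atBot tendsto_id
  have hkc : ∀ σ : ℝ, Continuous fun x : ℝ => ρ x * (Real.exp σ / (Real.exp σ + Real.exp x)) :=
    fun σ => hρc.mul (continuous_const.div (by fun_prop) fun x => by positivity)
  have hk0 : ∀ σ x : ℝ, 0 ≤ ρ x * (Real.exp σ / (Real.exp σ + Real.exp x)) := fun σ x =>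
    mul_nonneg (hρ0 x) (by positivity)
  have hlim : ∀ σ : ℝ, Tendsto (fun R : ℝ => ∫ x in Ioc (-R) R,
      ρ x * (Real.exp σ / (Real.exp σ + Real.exp x))) atTop
      (𝓝 (Real.pi * (symbol μ (Real.exp σ) / (symbol μ (Real.exp σ) + lam)))) := fun σ => by
    refine (tendsto_integral_transfer_im hμc hμ0 hμp hlam σ).congr' ?_
    filter_upwards [eventually_ge_atTop 0] with R hR
    rw [intervalIntegral.integral_of_le (by linarith)]
  have hkon : ∀ σ R : ℝ, IntegrableOn (fun x => ρ x * (Real.exp σ / (Real.exp σ + Real.exp x)))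
      (Ioc (-R) R) := fun σ R => ((hkc σ).integrableOn_Icc).mono_set Ioc_subset_Icc_self
  -- Nonnegativity upgrades the limit over symmetric intervals to absolute integrability.
  have hki : ∀ σ : ℝ, Integrable fun x => ρ x * (Real.exp σ / (Real.exp σ + Real.exp x)) :=
    fun σ => hcov.integrable_of_integral_tendsto_of_nonneg_ae _ (hkon σ)
      (ae_of_all _ (hk0 σ)) (hlim σ)
  have hkeq : ∀ σ : ℝ, ∫ x, ρ x * (Real.exp σ / (Real.exp σ + Real.exp x)) =
      Real.pi * (symbol μ (Real.exp σ) / (symbol μ (Real.exp σ) + lam)) := fun σ =>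
    hcov.integral_eq_of_tendsto _ (hki σ) (hlim σ)
  have hkle : ∀ σ : ℝ, ∫ x, ρ x * (Real.exp σ / (Real.exp σ + Real.exp x)) ≤ Real.pi :=
    fun σ => by
      rw [hkeq]
      have := symbol_pos hμc hμ0 hμp (Real.exp_pos σ)
      exact mul_le_of_le_one_right hpi.le (div_le_one_of_le₀ (by linarith) (by linarith))
  -- Total mass: for x ≤ R the reciprocal of the kernel is at most 1 + e^{R-σ}, which tends to 1 as
  -- σ → ∞, and each kernel integral is at most π because w/(w+λ) ≤ 1.
  have hbound : ∀ R : ℝ, ∫ x in Ioc (-R) R, ρ x ≤ Real.pi := fun R => by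
    have hlim' : Tendsto (fun σ : ℝ => Real.pi * (1 + Real.exp (-(σ - R)))) atTop
        (𝓝 (Real.pi * (1 + 0))) := by
      refine Tendsto.const_mul _ (Tendsto.const_add _ (Real.tendsto_exp_neg_atTop_nhds_zero.comp ?_))
      exact tendsto_atTop_add_const_right _ _ tendsto_id
    rw [add_zero, mul_one] at hlim'
    refine ge_of_tendsto' hlim' fun σ => ?_
    calc ∫ x in Ioc (-R) R, ρ x
        ≤ ∫ x in Ioc (-R) R, ρ x * (Real.exp σ / (Real.exp σ + Real.exp x)) *
            (1 + Real.exp (-(σ - R))) := by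
          refine setIntegral_mono_on ((hρc.integrableOn_Icc).mono_set Ioc_subset_Icc_self)
            ((hkon σ R).mul_const _) measurableSet_Ioc fun x hx => ?_
          rw [mul_assoc]
          refine le_mul_of_one_le_right (hρ0 x) ?_
          rw [div_mul_eq_mul_div, le_div_iff₀ (by positivity), one_mul, mul_add, mul_one,
            ← Real.exp_add, show σ + -(σ - R) = R by ring]
          have := Real.exp_le_exp.2 hx.2
          linarith
      _ = (∫ x in Ioc (-R) R, ρ x * (Real.exp σ / (Real.exp σ + Real.exp x))) *
            (1 + Real.exp (-(σ - R))) := integral_mul_const _ _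
      _ ≤ Real.pi * (1 + Real.exp (-(σ - R))) := by
          refine mul_le_mul_of_nonneg_right ?_ (by positivity)
          exact (setIntegral_le_integral (hki σ) (ae_of_all _ (hk0 σ))).trans (hkle σ)
  have hρi : Integrable ρ := hcov.integrable_of_integral_bounded_of_nonneg_ae Real.pi
    (fun R => (hρc.integrableOn_Icc).mono_set Ioc_subset_Icc_self) (ae_of_all _ hρ0)
    (Eventually.of_forall hbound)
  have hρle : ∫ x, ρ x ≤ Real.pi := le_of_tendsto' (hcov.integral_tendsto_of_countably_generated hρi)
    hbound
  -- The push-forward under r = e^x is the required measure, since (s+r)⁻¹ is s⁻¹ times the kernel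
  -- at s = e^σ.
  set m : Measure ℝ := volume.withDensity fun x => ENNReal.ofReal (ρ x / Real.pi) with hm
  have hdm : Measurable fun x => ENNReal.ofReal (ρ x / Real.pi) :=
    ENNReal.measurable_ofReal.comp (hρc.measurable.div_const _)
  refine ⟨m.map Real.exp, ?_, ?_, fun s hs => ?_⟩
  · rw [Measure.map_apply Real.measurable_exp MeasurableSet.univ, preimage_univ, hm,
      withDensity_apply _ MeasurableSet.univ, Measure.restrict_univ,
      ← ofReal_integral_eq_lintegral_ofReal (hρi.div_const _)
        (ae_of_all _ fun x => div_nonneg (hρ0 x) hpi.le), integral_div]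
    exact ENNReal.ofReal_le_one.2 (div_le_one_of_le₀ hρle hpi.le)
  · rw [ae_map_iff Real.measurable_exp.aemeasurable measurableSet_Ici]
    exact ae_of_all _ fun x => (Real.exp_pos x).le
  · obtain ⟨σ, rfl⟩ : ∃ σ, Real.exp σ = s := ⟨Real.log s, Real.exp_log hs⟩
    have hw := symbol_pos hμc hμ0 hμp hs
    rw [integral_map Real.measurable_exp.aemeasurable (by fun_prop), hm,
      integral_withDensity_eq_integral_toReal_smul hdm (ae_of_all _ fun x => ENNReal.ofReal_lt_top)]
    have h1 : ∀ x, (ENNReal.ofReal (ρ x / Real.pi)).toReal • (Real.exp σ + Real.exp x)⁻¹ =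
        ρ x * (Real.exp σ / (Real.exp σ + Real.exp x)) / (Real.pi * Real.exp σ) := fun x => by
      rw [ENNReal.toReal_ofReal (div_nonneg (hρ0 x) hpi.le), smul_eq_mul]
      field_simp
    simp only [h1]
    rw [integral_div, hkeq]
    field_simp

end

/-! ### Generating functions and the scalar fully discrete scheme. -/

section Coefficients

/-- A function with a power series expansion at the origin is smooth there and its Taylor
coefficients are those of the expansion. -/
theorem taylor_of_hasSum {a : ℕ → ℝ} {g : ℝ → ℝ}
    (h : ∀ ξ : ℝ, |ξ| < 1 → HasSum (fun k => ξ ^ k * a k) (g ξ)) :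
    (∀ m : ℕ, ContDiffAt ℝ m g 0) ∧ ∀ k, iteratedDeriv k g 0 / (k.factorial : ℝ) = a k := by
  have hp : HasFPowerSeriesAt g (FormalMultilinearSeries.ofScalars ℝ a) 0 := by
    rw [hasFPowerSeriesAt_iff]
    filter_upwards [Metric.ball_mem_nhds (0 : ℝ) one_pos] with ξ hξ
    simpa using h ξ (by simpa using hξ)
  refine ⟨fun m => hp.analyticAt.contDiffAt, fun k => ?_⟩
  have h1 := hp.analyticAt.hasFPowerSeriesAt.eq_formalMultilinearSeries hp
  simpa using congrArg (fun q => FormalMultilinearSeries.coeff q k) h1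

/-- Leibniz's rule divided by m! is the Cauchy product; it turns products of generating functions
into the discrete convolutions of the scheme. -/
theorem taylor_mul {f g : ℝ → ℝ} {m : ℕ} (hf : ContDiffAt ℝ m f 0) (hg : ContDiffAt ℝ m g 0) :
    iteratedDeriv m (f * g) 0 / (m.factorial : ℝ) = ∑ i ∈ Finset.range (m + 1),
      (iteratedDeriv i f 0 / (i.factorial : ℝ)) *
        (iteratedDeriv (m - i) g 0 / ((m - i).factorial : ℝ)) := by
  rw [iteratedDeriv_mul hf hg, Finset.sum_div]
  refine Finset.sum_congr rfl fun i hi => ?_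
  have hi' : i ≤ m := Nat.lt_succ_iff.1 (Finset.mem_range.1 hi)
  have h1 : ((m.choose i * i.factorial * (m - i).factorial : ℕ) : ℝ) = m.factorial := by
    rw [Nat.choose_mul_factorial_mul_factorial hi']
  push_cast at h1
  have h2 : (i.factorial : ℝ) ≠ 0 := by positivity
  have h3 : ((m - i).factorial : ℝ) ≠ 0 := by positivity
  have h4 : (m.choose i : ℝ) ≠ 0 := by exact_mod_cast (Nat.choose_pos hi').ne'
  rw [← h1]
  field_simp

end Coefficients

section

variable {μ : ℝ → ℝ}

theorem cqGenerating_eq_symbol (μ : ℝ → ℝ) (τ ξ : ℝ) :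
    cqGenerating μ τ ξ = symbol μ ((1 - ξ) / τ) := rfl

/-- Near ξ = 0 the generating function is the entire function `csymbol` composed with log((1-ξ)/τ).
-/
theorem contDiffAt_cqGenerating (hμc : ContinuousOn μ (Icc 0 1)) {τ : ℝ} (hτ : 0 < τ) (m : ℕ) :
    ContDiffAt ℝ m (cqGenerating μ τ) 0 := by
  have h1 : ContDiffAt ℝ m (fun ξ : ℝ => (csymbol μ (Real.log ((1 - ξ) / τ) : ℝ)).re) 0 := by
    have h2 : ContDiff ℝ m (csymbol μ) :=
      (differentiable_csymbol hμc).contDiff.restrict_scalars ℝ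
    have h3 : ContDiffAt ℝ m (fun ξ : ℝ => Real.log ((1 - ξ) / τ)) 0 := by
      refine ContDiffAt.log (by fun_prop) ?_
      have : (0 : ℝ) < (1 - 0) / τ := by simpa using hτ
      exact this.ne'
    have h4 : ContDiffAt ℝ m (fun ξ : ℝ => ((Real.log ((1 - ξ) / τ) : ℝ) : ℂ)) 0 :=
      Complex.ofRealCLM.contDiff.contDiffAt.comp (0 : ℝ) h3
    exact Complex.reCLM.contDiff.contDiffAt.comp (0 : ℝ) (h2.contDiffAt.comp (0 : ℝ) h4)
  refine h1.congr_of_eventuallyEq ?_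
  filter_upwards [Iio_mem_nhds (zero_lt_one : (0 : ℝ) < 1)] with ξ hξ
  have hpos : 0 < (1 - ξ) / τ := div_pos (sub_pos.2 hξ) hτ
  rw [csymbol_ofReal, Complex.ofReal_re, Real.exp_log hpos, cqGenerating_eq_symbol]

/-- The mixtures of `(1 + τ r)⁻ⁿ` solve the scalar fully discrete problem. -/
theorem cqSum_mixture (hμc : ContinuousOn μ (Icc 0 1)) (hμ0 : ∀ α ∈ Icc (0 : ℝ) 1, 0 ≤ μ α)
    (hμp : 0 < μ 0) {lam : ℝ} (hlam : 0 ≤ lam) {τ : ℝ} (hτ : 0 < τ) {ν : Measure ℝ}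
    [IsFiniteMeasure ν] (hν : ∀ᵐ r ∂ν, 0 ≤ r)
    (hs : ∀ s : ℝ, 0 < s → ∫ r, (s + r)⁻¹ ∂ν = symbol μ s / (s * (symbol μ s + lam)))
    {n : ℕ} (hn : 1 ≤ n) :
    cqSum μ τ (fun j => ∫ r, ((1 + τ * r) ^ j)⁻¹ ∂ν) n + lam * ∫ r, ((1 + τ * r) ^ n)⁻¹ ∂ν =
      cqSum μ τ (fun _ => (1 : ℝ)) n := by
  set Y : ℕ → ℝ := fun j => ∫ r, ((1 + τ * r) ^ j)⁻¹ ∂ν with hY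
  -- The generating function of Y₁, Y₂, …, by the geometric series under the integral. It is τ⁻¹
  -- times the Stieltjes transform of ν at (1-ξ)/τ.
  let g : ℝ → ℝ := fun ξ => ∫ r, (1 + τ * r - ξ)⁻¹ ∂ν
  have hg : ∀ ξ : ℝ, |ξ| < 1 → HasSum (fun k => ξ ^ k * Y (k + 1)) (g ξ) := by
    intro ξ hξ
    have h1 : ∀ k : ℕ, ξ ^ k * Y (k + 1) = ∫ r, ξ ^ k * ((1 + τ * r) ^ (k + 1))⁻¹ ∂ν := fun k => by
      rw [hY, integral_const_mul]
    simp only [h1]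
    refine hasSum_integral_of_dominated_convergence (fun k _ => |ξ| ^ k) (fun k => ?_) (fun k => ?_)
      (ae_of_all _ fun _ => summable_geometric_of_lt_one (abs_nonneg _) hξ)
      (integrable_const _) ?_
    · exact Measurable.aestronglyMeasurable (by fun_prop)
    · filter_upwards [hν] with r hr
      have h2 : 1 ≤ (1 + τ * r) ^ (k + 1) :=
        one_le_pow₀ (le_add_of_nonneg_right (mul_nonneg hτ.le hr))
      rw [norm_mul, norm_pow, Real.norm_eq_abs, Real.norm_of_nonneg (by positivity)]
      exact mul_le_of_le_one_right (by positivity) (inv_le_one_of_one_le₀ h2)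
    · filter_upwards [hν] with r hr
      have hb : 1 ≤ 1 + τ * r := le_add_of_nonneg_right (mul_nonneg hτ.le hr)
      have hb0 : 0 < 1 + τ * r := by linarith
      have hlt : |ξ / (1 + τ * r)| < 1 := by
        rw [abs_div, abs_of_pos hb0, div_lt_one hb0]
        linarith
      have hne : 1 + τ * r - ξ ≠ 0 := by
        have := (abs_lt.1 hξ).2
        linarith
      have h2 := (hasSum_geometric_of_abs_lt_one hlt).mul_left (1 + τ * r)⁻¹
      have h3 : (1 + τ * r)⁻¹ * (1 - ξ / (1 + τ * r))⁻¹ = (1 + τ * r - ξ)⁻¹ := by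
        rw [← mul_inv, mul_sub, mul_one, mul_div_cancel₀ _ hb0.ne']
      rw [h3] at h2
      refine h2.congr_fun fun k => ?_
      rw [div_pow, pow_succ, mul_inv]
      field_simp
  let h : ℝ → ℝ := fun ξ => (1 - ξ)⁻¹
  have hh : ∀ ξ : ℝ, |ξ| < 1 → HasSum (fun k => ξ ^ k * (1 : ℝ)) (h ξ) := fun ξ hξ => by
    simpa using hasSum_geometric_of_abs_lt_one hξ
  obtain ⟨hgc, hgk⟩ := taylor_of_hasSum hg
  obtain ⟨hhc, hhk⟩ := taylor_of_hasSum hh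
  set f := cqGenerating μ τ with hf
  have hfc : ∀ m : ℕ, ContDiffAt ℝ m f 0 := contDiffAt_cqGenerating hμc hτ
  -- The whole scheme as one identity (ω+λ)g = ω/(1-ξ); the factor 1/(1-ξ) encodes the constant
  -- initial value.
  have heq : f * g + lam • g =ᶠ[𝓝 0] f * h := by
    filter_upwards [Iio_mem_nhds (zero_lt_one : (0 : ℝ) < 1)] with ξ hξ
    have hξ' : 0 < 1 - ξ := sub_pos.2 hξ
    have hpos : 0 < (1 - ξ) / τ := div_pos hξ' hτ
    have hw := symbol_pos hμc hμ0 hμp hpos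
    have hgξ : g ξ = symbol μ ((1 - ξ) / τ) / ((1 - ξ) * (symbol μ ((1 - ξ) / τ) + lam)) := by
      have h1 : g ξ = τ⁻¹ * ∫ r, ((1 - ξ) / τ + r)⁻¹ ∂ν := by
        rw [← integral_const_mul]
        refine integral_congr_ae (ae_of_all _ fun r => ?_)
        simp only
        rw [← mul_inv, mul_add, mul_div_cancel₀ _ hτ.ne']
        ring_nf
      have hwl : symbol μ ((1 - ξ) / τ) + lam ≠ 0 := by linarith
      rw [h1, hs _ hpos]
      field_simp
    have hwl : symbol μ ((1 - ξ) / τ) + lam ≠ 0 := by linarith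
    simp only [Pi.add_apply, Pi.mul_apply, Pi.smul_apply, smul_eq_mul, hgξ, hf, h,
      cqGenerating_eq_symbol]
    field_simp
  -- The convolution starts at j = 1, so step n corresponds to the coefficient of ξ^{n-1}.
  obtain ⟨m, rfl⟩ : ∃ m, n = m + 1 := ⟨n - 1, by omega⟩
  have hD := heq.iteratedDeriv_eq m
  have hfg : ContDiffAt ℝ m (f * g) 0 := (hfc m).mul (hgc m)
  have hlg : ContDiffAt ℝ m (lam • g) 0 := (hgc m).const_smul lam
  rw [iteratedDeriv_add hfg hlg, iteratedDeriv_const_smul_field] at hD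
  have hD' := congrArg (fun x => x / (m.factorial : ℝ)) hD
  simp only [add_div, smul_eq_mul, mul_div_assoc] at hD'
  rw [taylor_mul (hfc m) (hgc m), taylor_mul (hfc m) (hhc m), hgk] at hD'
  simp only [hgk, hhk] at hD'
  have hsum : ∀ φ : ℕ → ℝ, cqSum μ τ φ (m + 1) = ∑ i ∈ Finset.range (m + 1),
      (iteratedDeriv i f 0 / (i.factorial : ℝ)) * φ (m - i + 1) := fun φ => by
    refine Finset.sum_nbij' (fun j => m + 1 - j) (fun i => m + 1 - i) ?_ ?_ ?_ ?_ ?_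
    · intro j hj; simp at hj ⊢; omega
    · intro j hj; simp at hj ⊢; omega
    · intro j hj; simp at hj ⊢; omega
    · intro j hj; simp at hj ⊢; omega
    · intro j hj
      have h1 : m - (m + 1 - j) + 1 = j := by simp at hj; omega
      simp only [h1]
      rfl
  rw [hsum, hsum]
  exact hD'

/-- The weight b₀ is w(1/τ). Its positivity makes b₀ + λ invertible, so each time step is solvable.
-/
theorem cqWeight_zero_pos (hμc : ContinuousOn μ (Icc 0 1)) (hμ0 : ∀ α ∈ Icc (0 : ℝ) 1, 0 ≤ μ α)
    (hμp : 0 < μ 0) {τ : ℝ} (hτ : 0 < τ) : 0 < cqWeight μ τ 0 := by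
  rw [cqWeight, iteratedDeriv_zero, Nat.factorial_zero, Nat.cast_one, div_one,
    cqGenerating_eq_symbol]
  exact symbol_pos hμc hμ0 hμp (by simpa using hτ)

/-- The scalar fully discrete problem is uniquely solvable. -/
theorem cqSum_unique (hμc : ContinuousOn μ (Icc 0 1)) (hμ0 : ∀ α ∈ Icc (0 : ℝ) 1, 0 ≤ μ α)
    (hμp : 0 < μ 0) {lam : ℝ} (hlam : 0 ≤ lam) {τ : ℝ} (hτ : 0 < τ) {N : ℕ} {Y Z : ℕ → ℝ}
    (h : ∀ n ∈ Finset.Icc 1 N, cqSum μ τ Y n + lam * Y n = cqSum μ τ Z n + lam * Z n) :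
    ∀ n ∈ Finset.Icc 1 N, Y n = Z n := by
  intro n
  induction n using Nat.strong_induction_on with
  | _ n ih =>
    intro hn
    have hn' := Finset.mem_Icc.1 hn
    have hsplit : ∀ φ : ℕ → ℝ, cqSum μ τ φ n =
        (∑ j ∈ Finset.Ico 1 n, cqWeight μ τ (n - j) • φ j) + cqWeight μ τ 0 * φ n := fun φ => by
      rw [cqSum, ← Finset.sum_Ico_add_eq_sum_Icc hn'.1, Nat.sub_self, smul_eq_mul]
    have h1 := h n hn
    have h2 : ∑ j ∈ Finset.Ico 1 n, cqWeight μ τ (n - j) • Y j =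
        ∑ j ∈ Finset.Ico 1 n, cqWeight μ τ (n - j) • Z j := by
      refine Finset.sum_congr rfl fun j hj => ?_
      have hj' := Finset.mem_Ico.1 hj
      rw [ih j hj'.2 (Finset.mem_Icc.2 ⟨hj'.1, by omega⟩)]
    rw [hsplit Y, hsplit Z, h2] at h1
    have h3 : 0 < cqWeight μ τ 0 + lam := by
      linarith [cqWeight_zero_pos hμc hμ0 hμp hτ]
    have h4 : (cqWeight μ τ 0 + lam) * Y n = (cqWeight μ τ 0 + lam) * Z n := by linarith
    exact mul_left_cancel₀ h3.ne' h4

/-! ### The scalar relaxation equation and the scalar error. -/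

theorem symbol_mono (hμc : ContinuousOn μ (Icc 0 1)) (hμ0 : ∀ α ∈ Icc (0 : ℝ) 1, 0 ≤ μ α)
    {p : ℝ} (hp : 1 ≤ p) : symbol μ 1 ≤ symbol μ p := by
  refine intervalIntegral.integral_mono_on zero_le_one
    (intervalIntegrable_symbol hμc (Real.continuous_const_rpow one_ne_zero))
    (intervalIntegrable_symbol hμc (Real.continuous_const_rpow (by linarith))) fun α hα => ?_
  exact mul_le_mul_of_nonneg_right (Real.rpow_le_rpow zero_le_one hp hα.1) (hμ0 α hα)

/-- The finite Laplace transform of a mixture of decaying exponentials. -/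
theorem laplace_mixture {ν : Measure ℝ} [IsFiniteMeasure ν] (hν : ∀ᵐ r ∂ν, 0 ≤ r) {T : ℝ}
    (hT : 0 < T) {p : ℝ} (hp : 1 ≤ p) :
    |(∫ t in (0 : ℝ)..T, Real.exp (-(p * t)) * ∫ r, Real.exp (-(r * t)) ∂ν) -
      ∫ r, (p + r)⁻¹ ∂ν| ≤ ν.real univ * Real.exp (-(p * T)) := by
  have hint : Integrable (Function.uncurry fun t r : ℝ => Real.exp (-(p * t)) * Real.exp (-(r * t)))
      ((volume.restrict (Ioc 0 T)).prod ν) := by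
    have hm : Measurable (Function.uncurry
        fun t r : ℝ => Real.exp (-(p * t)) * Real.exp (-(r * t))) := by
      unfold Function.uncurry
      fun_prop
    refine Integrable.of_bound hm.aestronglyMeasurable 1 ?_
    have h1 : ∀ᵐ q ∂((volume.restrict (Ioc 0 T)).prod ν), q.1 ∈ Ioc 0 T :=
      Measure.quasiMeasurePreserving_fst.ae (ae_restrict_mem measurableSet_Ioc)
    have h2 : ∀ᵐ q ∂((volume.restrict (Ioc 0 T)).prod ν), 0 ≤ q.2 :=
      Measure.quasiMeasurePreserving_snd.ae hν
    filter_upwards [h1, h2] with q hq1 hq2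
    simp only [Function.uncurry_def]
    rw [← Real.exp_add, Real.norm_of_nonneg (Real.exp_pos _).le]
    refine Real.exp_le_one_iff.2 ?_
    nlinarith [mul_nonneg hq2 hq1.1.le, mul_nonneg (zero_le_one.trans hp) hq1.1.le]
  have hswap : ∫ t in (0 : ℝ)..T, Real.exp (-(p * t)) * ∫ r, Real.exp (-(r * t)) ∂ν =
      ∫ r, (∫ t in Ioc 0 T, Real.exp (-(p * t)) * Real.exp (-(r * t))) ∂ν := by
    rw [intervalIntegral.integral_of_le hT.le, ← integral_integral_swap hint]
    simp only [integral_const_mul]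
  have hinner : ∀ r : ℝ, 0 ≤ r → ∫ t in Ioc 0 T, Real.exp (-(p * t)) * Real.exp (-(r * t)) =
      (p + r)⁻¹ - (p + r)⁻¹ * Real.exp (-((p + r) * T)) := fun r hr => by
    have hpr : p + r ≠ 0 := by linarith
    rw [← intervalIntegral.integral_of_le hT.le]
    have hd : ∀ t ∈ uIcc 0 T, HasDerivAt (fun t => -((p + r)⁻¹ * Real.exp (-((p + r) * t))))
        (Real.exp (-(p * t)) * Real.exp (-(r * t))) t := fun t _ => by
      have h1 := (((hasDerivAt_id' t).const_mul (-(p + r))).exp.const_mul (p + r)⁻¹).neg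
      simp only [neg_mul, mul_one] at h1
      refine h1.congr_deriv ?_
      rw [← Real.exp_add, show -(p * t) + -(r * t) = -((p + r) * t) by ring]
      field_simp
    rw [intervalIntegral.integral_eq_sub_of_hasDerivAt hd
      (Continuous.intervalIntegrable (by fun_prop) _ _)]
    simp
    ring
  have hi1 : Integrable (fun r => ∫ t in Ioc 0 T, Real.exp (-(p * t)) * Real.exp (-(r * t))) ν :=
    hint.integral_prod_right
  have hi2 : Integrable (fun r => (p + r)⁻¹) ν := by
    refine Integrable.of_bound (Measurable.aestronglyMeasurable (by fun_prop)) 1 ?_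
    filter_upwards [hν] with r hr
    rw [Real.norm_of_nonneg (by positivity)]
    exact inv_le_one_of_one_le₀ (by linarith)
  rw [hswap, ← integral_sub hi1 hi2, ← Real.norm_eq_abs, mul_comm]
  refine norm_integral_le_of_norm_le_const ?_
  filter_upwards [hν] with r hr
  rw [hinner r hr, sub_sub_cancel_left, norm_neg, norm_mul, Real.norm_of_nonneg (by positivity),
    Real.norm_of_nonneg (Real.exp_pos _).le]
  refine (mul_le_of_le_one_left (Real.exp_pos _).le
    (inv_le_one_of_one_le₀ (by linarith))).trans (Real.exp_le_exp.2 ?_)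
  nlinarith [mul_nonneg hr hT.le]

theorem continuousOn_mixture {ν : Measure ℝ} [IsFiniteMeasure ν] (hν : ∀ᵐ r ∂ν, 0 ≤ r) (T : ℝ) :
    ContinuousOn (fun t => ∫ r, Real.exp (-(r * t)) ∂ν) (Icc 0 T) := by
  refine continuousOn_of_dominated (bound := fun _ => 1) (fun t _ => ?_) (fun t ht => ?_)
    (integrable_const _) (ae_of_all _ fun r => by fun_prop)
  · exact Measurable.aestronglyMeasurable (by fun_prop)
  · filter_upwards [hν] with r hr
    rw [Real.norm_of_nonneg (Real.exp_pos _).le]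
    exact Real.exp_le_one_iff.2 (neg_nonpos.2 (mul_nonneg hr ht.1))

/-- A linear combination of absolutely continuous functions that solves the scalar distributed
order relaxation equation is a mixture of decaying exponentials. -/
theorem eq_mixture_of_relaxation (hμc : ContinuousOn μ (Icc 0 1))
    (hμ0 : ∀ α ∈ Icc (0 : ℝ) 1, 0 ≤ μ α) (hμp : 0 < μ 0) {lam : ℝ} (hlam : 0 ≤ lam)
    {ν : Measure ℝ} [IsFiniteMeasure ν] (hν : ∀ᵐ r ∂ν, 0 ≤ r)
    (hs : ∀ s : ℝ, 0 < s → ∫ r, (s + r)⁻¹ ∂ν = symbol μ s / (s * (symbol μ s + lam)))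
    {ι : Type*} [Fintype ι] (c : ι → ℝ) (y : ι → ℝ → ℝ) {T : ℝ} (hT : 0 < T)
    (hy : ∀ i, AbsolutelyContinuousOnInterval (y i) 0 T)
    (heq : ∀ t ∈ Ioc 0 T, ∑ i, c i * distCaputo μ (y i) t = -(lam * ∑ i, c i * y i t)) :
    ∀ t ∈ Icc 0 T, ∑ i, c i * y i t = (∑ i, c i * y i 0) * ∫ r, Real.exp (-(r * t)) ∂ν := by
  -- The transform is estimated for each summand separately, so linearity of `distCaputo` is never
  -- needed.
  choose C hC using fun i => laplace_distCaputo hμc hμ0 hT (hy i)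
  set u : ℝ → ℝ := fun t => ∑ i, c i * y i t with hu
  set z : ℝ → ℝ := fun t => ∫ r, Real.exp (-(r * t)) ∂ν with hz
  have hyc : ∀ i, ContinuousOn (y i) (Icc 0 T) := fun i => by
    have := (hy i).continuousOn
    rwa [uIcc_of_le hT.le] at this
  have huc : ContinuousOn u (Icc 0 T) :=
    continuousOn_finsetSum _ fun i _ => continuousOn_const.mul (hyc i)
  have hzc : ContinuousOn z (Icc 0 T) := continuousOn_mixture hν T
  have hei : ∀ (p : ℝ) {f : ℝ → ℝ}, ContinuousOn f (Icc 0 T) →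
      IntervalIntegrable (fun t => Real.exp (-(p * t)) * f t) volume 0 T := fun p f hf => by
    refine ContinuousOn.intervalIntegrable ?_
    rw [uIcc_of_le hT.le]
    exact ContinuousOn.mul (Continuous.continuousOn (by fun_prop)) hf
  have hw1 := symbol_pos hμc hμ0 hμp one_pos
  set A : ℝ := ∑ i, |c i| * C i
  have hzero : EqOn (fun t => u t - u 0 * z t) 0 (Icc 0 T) := by
    -- The first term comes from the equation for u, after division by w(p) + λ ≥ w(1) for p ≥ 1;
    -- the second comes from truncating the transform of the mixture.
    refine eqOn_zero_of_laplace_bound (C := |A| / symbol μ 1 + |u 0| * ν.real univ) hT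
      (huc.sub (continuousOn_const.mul hzc)) fun p hp => ?_
    have hp0 : 0 < p := by linarith
    have hw : 0 < symbol μ p := symbol_pos hμc hμ0 hμp hp0
    set Lu := ∫ t in (0 : ℝ)..T, Real.exp (-(p * t)) * u t with hLu
    set Lz := ∫ t in (0 : ℝ)..T, Real.exp (-(p * t)) * z t with hLz
    set ε := Real.exp (-(p * T)) with hε
    have hεpos : 0 < ε := Real.exp_pos _
    have hLuy : Lu = ∑ i, c i * ∫ t in (0 : ℝ)..T, Real.exp (-(p * t)) * y i t := by
      simp only [← intervalIntegral.integral_const_mul]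
      rw [← intervalIntegral.integral_finsetSum fun i _ => (hei p (hyc i)).const_mul (c i)]
      refine intervalIntegral.integral_congr fun t _ => ?_
      simp only [hu, Finset.mul_sum]
      exact Finset.sum_congr rfl fun i _ => by ring
    have hLD : ∑ i, c i * ∫ t in (0 : ℝ)..T, Real.exp (-(p * t)) * distCaputo μ (y i) t =
        -(lam * Lu) := by
      simp only [← intervalIntegral.integral_const_mul]
      rw [← intervalIntegral.integral_finsetSum fun i _ => ((hC i p hp).1).const_mul (c i),
        hLu, ← intervalIntegral.integral_const_mul, ← intervalIntegral.integral_neg]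
      refine intervalIntegral.integral_congr_ae (ae_of_all _ fun t ht => ?_)
      rw [uIoc_of_le hT.le] at ht
      have h1 := heq t ht
      calc ∑ i, c i * (Real.exp (-(p * t)) * distCaputo μ (y i) t)
          = Real.exp (-(p * t)) * ∑ i, c i * distCaputo μ (y i) t := by
            rw [Finset.mul_sum]; exact Finset.sum_congr rfl fun i _ => by ring
        _ = -(lam * (Real.exp (-(p * t)) * u t)) := by rw [h1]; ring
    have hmain : |-(lam * Lu) - symbol μ p / p * (p * Lu - u 0)| ≤ A * ε := by
      have h1 : -(lam * Lu) - symbol μ p / p * (p * Lu - u 0) = ∑ i, c i *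
          ((∫ t in (0 : ℝ)..T, Real.exp (-(p * t)) * distCaputo μ (y i) t) -
            symbol μ p / p * (p * (∫ t in (0 : ℝ)..T, Real.exp (-(p * t)) * y i t) - y i 0)) := by
        rw [← hLD, hLuy]
        simp only [hu, Finset.mul_sum, ← Finset.sum_sub_distrib]
        exact Finset.sum_congr rfl fun i _ => by ring
      rw [h1, Finset.sum_mul]
      refine (Finset.abs_sum_le_sum_abs _ _).trans (Finset.sum_le_sum fun i _ => ?_)
      rw [abs_mul, mul_assoc]
      exact mul_le_mul_of_nonneg_left (hC i p hp).2 (abs_nonneg _)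
    have hmix := laplace_mixture hν hT hp
    rw [hs p hp0] at hmix
    have hsplit : ∫ t in (0 : ℝ)..T, Real.exp (-(p * t)) * (u t - u 0 * z t) = Lu - u 0 * Lz := by
      rw [hLu, hLz, ← intervalIntegral.integral_const_mul,
        ← intervalIntegral.integral_sub (hei p huc) ((hei p hzc).const_mul _)]
      refine intervalIntegral.integral_congr fun t _ => ?_
      ring
    have hwl : 0 < symbol μ p + lam := by linarith
    set F := symbol μ p / (p * (symbol μ p + lam)) with hF
    -- The transformed equation is solved for `Lu`: up to sign, its residual is (w(p)+λ)(Lu -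
    -- u(0)F).
    have h2 : |Lu - u 0 * F| ≤ |A| / symbol μ 1 * ε := by
      have h3 : -(lam * Lu) - symbol μ p / p * (p * Lu - u 0) =
          -((symbol μ p + lam) * (Lu - u 0 * F)) := by
        rw [hF]
        field_simp
        ring
      rw [h3, abs_neg, abs_mul, abs_of_pos hwl] at hmain
      have h4 : symbol μ 1 ≤ symbol μ p + lam := by linarith [symbol_mono hμc hμ0 hp]
      rw [div_mul_eq_mul_div, le_div_iff₀ hw1]
      calc |Lu - u 0 * F| * symbol μ 1 ≤ |Lu - u 0 * F| * (symbol μ p + lam) := by gcongr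
        _ ≤ A * ε := by linarith
        _ ≤ |A| * ε := by gcongr; exact le_abs_self _
    rw [hsplit, add_mul]
    calc |Lu - u 0 * Lz| = |(Lu - u 0 * F) - u 0 * (Lz - F)| := by ring_nf
      _ ≤ |Lu - u 0 * F| + |u 0 * (Lz - F)| := abs_sub _ _
      _ ≤ _ := by
        refine add_le_add h2 ?_
        rw [abs_mul, mul_assoc]
        exact mul_le_mul_of_nonneg_left hmix (abs_nonneg _)
  intro t ht
  exact sub_eq_zero.1 (hzero ht)

/-- The scalar error estimate. -/
theorem abs_mixture_sub_le {ν : Measure ℝ} (hν1 : ν univ ≤ 1) (hν : ∀ᵐ r ∂ν, 0 ≤ r) {τ : ℝ}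
    (hτ : 0 < τ) {n : ℕ} (hn : 1 ≤ n) :
    |(∫ r, Real.exp (-(r * (n * τ))) ∂ν) - ∫ r, ((1 + τ * r) ^ n)⁻¹ ∂ν| ≤ 4 / n := by
  have hfin : IsFiniteMeasure ν := ⟨hν1.trans_lt ENNReal.one_lt_top⟩
  have hi1 : Integrable (fun r => Real.exp (-(r * (n * τ)))) ν := by
    refine Integrable.of_bound (Measurable.aestronglyMeasurable (by fun_prop)) 1 ?_
    filter_upwards [hν] with r hr
    rw [Real.norm_of_nonneg (Real.exp_pos _).le]
    exact Real.exp_le_one_iff.2 (neg_nonpos.2 (by positivity))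
  have hi2 : Integrable (fun r => ((1 + τ * r) ^ n)⁻¹) ν := by
    refine Integrable.of_bound (Measurable.aestronglyMeasurable (by fun_prop)) 1 ?_
    filter_upwards [hν] with r hr
    rw [Real.norm_of_nonneg (by positivity)]
    exact inv_le_one_of_one_le₀ (one_le_pow₀ (le_add_of_nonneg_right (by positivity)))
  rw [← integral_sub hi1 hi2, ← Real.norm_eq_abs]
  have h1 : ∀ᵐ r ∂ν, ‖Real.exp (-(r * (n * τ))) - ((1 + τ * r) ^ n)⁻¹‖ ≤ 4 / n := by
    filter_upwards [hν] with r hr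
    have := abs_exp_sub_inv_pow_le (mul_nonneg hτ.le hr) hn
    rwa [show (n : ℝ) * (τ * r) = r * (n * τ) by ring] at this
  refine (norm_integral_le_of_norm_le_const h1).trans ?_
  refine mul_le_of_le_one_right (by positivity) ?_
  exact ENNReal.toReal_le_of_le_ofReal zero_le_one (by simpa using hν1)

end

/-! ### From finite element functions to scalar coordinates. -/

section FiniteElement

variable {d : ℕ} {Ω : Set (EuclideanSpace ℝ (Fin d))}
  {K : Geometry.SimplicialComplex ℝ (EuclideanSpace ℝ (Fin d))}

/-- Every linear functional on the finite element space is a combination of point values. -/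
theorem exists_eq_sum_evaluations (hK : IsTriangulation Ω K) :
    ∃ V : Finset (EuclideanSpace ℝ (Fin d)), ∀ ℓ : feSpace Ω K →ₗ[ℝ] ℝ,
      ∃ c : V → ℝ, ∀ f : feSpace Ω K, ℓ f = ∑ x : V, c x * f.1 x := by
  classical
  obtain ⟨V, hV⟩ := exists_finset_vertices hK
  refine ⟨V, fun ℓ => ?_⟩
  -- Vertex values determine the function, so a left inverse of evaluation recovers it and the
  -- functional factors through finitely many point values.
  obtain ⟨G, hG⟩ := LinearMap.exists_leftInverse_of_injective (evalOn Ω K V)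
    (LinearMap.ker_eq_bot.2 (evalOn_injective hK hV))
  refine ⟨fun x => ℓ (G fun j => if x = j then 1 else 0), fun f => ?_⟩
  have h1 : ℓ f = (ℓ ∘ₗ G) (evalOn Ω K V f) := by
    have := LinearMap.congr_fun hG f
    simp only [LinearMap.comp_apply, LinearMap.id_apply] at this ⊢
    rw [this]
  rw [h1, LinearMap.pi_apply_eq_sum_univ (ℓ ∘ₗ G)]
  refine Finset.sum_congr rfl fun x _ => ?_
  rw [smul_eq_mul, mul_comm, LinearMap.comp_apply]
  rfl

/-- The `L²(Ω)` inner product as a bilinear form on the finite element space. -/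
noncomputable def l2Form (hΩ : IsConvexPolygonalDomain Ω) :
    feSpace Ω K →ₗ[ℝ] feSpace Ω K →ₗ[ℝ] ℝ :=
  LinearMap.mk₂ ℝ (fun f g => l2Inner Ω f.1 g.1)
    (fun f₁ f₂ g => l2Inner_add_left (memLp_of_mem_feSpace hΩ f₁.2) (memLp_of_mem_feSpace hΩ f₂.2)
      (memLp_of_mem_feSpace hΩ g.2))
    (fun c f g => l2Inner_smul_left c f.1 g.1)
    (fun f g₁ g₂ => by
      rw [l2Inner_comm, l2Inner_comm f.1 g₁.1, l2Inner_comm f.1 g₂.1]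
      exact l2Inner_add_left (memLp_of_mem_feSpace hΩ g₁.2) (memLp_of_mem_feSpace hΩ g₂.2)
        (memLp_of_mem_feSpace hΩ f.2))
    (fun c f g => by
      rw [l2Inner_comm, l2Inner_comm f.1 g.1]
      exact l2Inner_smul_left c g.1 f.1)

/-- The Dirichlet form as a bilinear form on the finite element space. -/
noncomputable def energyForm (hΩ : IsConvexPolygonalDomain Ω) (hK : IsTriangulation Ω K) :
    feSpace Ω K →ₗ[ℝ] feSpace Ω K →ₗ[ℝ] ℝ :=
  LinearMap.mk₂ ℝ (fun f g => dirichletForm Ω f.1 g.1)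
    (fun f₁ f₂ g => dirichletForm_add_left hΩ hK f₁.2 f₂.2 g.2)
    (fun c f g => dirichletForm_smul_left hK c f.2 g.1)
    (fun f g₁ g₂ => by
      rw [dirichletForm_comm, dirichletForm_comm f.1 g₁.1, dirichletForm_comm f.1 g₂.1]
      exact dirichletForm_add_left hΩ hK g₁.2 g₂.2 f.2)
    (fun c f g => by
      rw [dirichletForm_comm, dirichletForm_comm f.1 g.1]
      exact dirichletForm_smul_left hK c g.2 f.1)

/-- The discrete Laplacian acts on the coordinates of an eigenbasis by multiplication. -/
theorem l2Inner_negDiscreteLaplacian {e φ ψ : EuclideanSpace ℝ (Fin d) → ℝ} {lam : ℝ}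
    (he : e ∈ feSpace Ω K)
    (hlam : ∀ f ∈ feSpace Ω K, dirichletForm Ω e f = lam * l2Inner Ω e f)
    (h : IsNegDiscreteLaplacian Ω K φ ψ) : l2Inner Ω e ψ = lam * l2Inner Ω e φ := by
  rw [l2Inner_comm, h.2.2 e he, dirichletForm_comm, hlam φ h.1]

/-- Test the projection against itself, apply the Cauchy–Schwarz inequality and divide by the norm
unless it is zero. -/
theorem l2Norm_projection_le (hΩ : IsConvexPolygonalDomain Ω)
    {v p : EuclideanSpace ℝ (Fin d) → ℝ} (hv : MemLp v 2 (volume.restrict Ω))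
    (h : IsL2Projection Ω K v p) : l2Norm Ω p ≤ l2Norm Ω v := by
  have hp := memLp_of_mem_feSpace hΩ h.1
  have h1 : l2Norm Ω p * l2Norm Ω p ≤ l2Norm Ω v * l2Norm Ω p := by
    have h2 : l2Norm Ω p * l2Norm Ω p = l2Inner Ω v p := by
      rw [← pow_two, l2Norm_eq_sqrt hp, Real.sq_sqrt (l2Inner_self_nonneg p), h.2 p h.1]
    exact h2.trans_le (l2Inner_le_l2Norm_mul hv hp)
  have h3 : 0 ≤ l2Norm Ω p := ENNReal.toReal_nonneg
  rcases h3.eq_or_lt with h0 | h0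
  · rw [← h0]; exact ENNReal.toReal_nonneg
  · exact le_of_mul_le_mul_right h1 h0

variable {μ : ℝ → ℝ}

/-- The coordinates of a semidiscrete solution are mixtures of decaying exponentials. -/
theorem IsSemidiscreteSolution.l2Inner_eq (hμc : ContinuousOn μ (Icc 0 1))
    (hμ0 : ∀ α ∈ Icc (0 : ℝ) 1, 0 ≤ μ α) (hμp : 0 < μ 0)
    (hΩ : IsConvexPolygonalDomain Ω) (hK : IsTriangulation Ω K) {T : ℝ} (hT : 0 < T)
    {vh : EuclideanSpace ℝ (Fin d) → ℝ} {u : ℝ → EuclideanSpace ℝ (Fin d) → ℝ}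
    (hu : IsSemidiscreteSolution μ T Ω K vh u)
    {lam : ℝ} (hlam : 0 ≤ lam) {e : EuclideanSpace ℝ (Fin d) → ℝ} (he : e ∈ feSpace Ω K)
    (hel : ∀ f ∈ feSpace Ω K, dirichletForm Ω e f = lam * l2Inner Ω e f)
    {ν : Measure ℝ} [IsFiniteMeasure ν] (hν : ∀ᵐ r ∂ν, 0 ≤ r)
    (hs : ∀ s : ℝ, 0 < s → ∫ r, (s + r)⁻¹ ∂ν = symbol μ s / (s * (symbol μ s + lam)))
    {t : ℝ} (ht : t ∈ Icc 0 T) :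
    l2Inner Ω e (u t) = l2Inner Ω e vh * ∫ r, Real.exp (-(r * t)) ∂ν := by
  obtain ⟨V, hV⟩ := exists_eq_sum_evaluations hK
  -- Time regularity and the fractional derivative are given pointwise in space. Writing the
  -- coordinate as a combination of point values carries both over to it.
  obtain ⟨c, hc⟩ := hV (l2Form (K := K) hΩ ⟨e, he⟩)
  have hc' : ∀ f (hf : f ∈ feSpace Ω K), l2Inner Ω e f = ∑ x : V, c x * f x := fun f hf =>
    hc ⟨f, hf⟩
  have h := eq_mixture_of_relaxation hμc hμ0 hμp hlam hν hs c (fun x s => u s x) hT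
    (fun x => hu.absCont x) (fun s hs => ?_) t ht
  · rw [hc' _ (hu.mem t ht), h, ← hc' (u 0) (hu.mem 0 (left_mem_Icc.2 hT.le)), hu.init]
  · have heq := hu.equation s hs
    have h1 := l2Inner_negDiscreteLaplacian he hel heq
    rw [hc' _ heq.2.1, hc' _ heq.1] at h1
    rw [← h1, ← Finset.sum_neg_distrib]
    exact Finset.sum_congr rfl fun x _ => by ring

/-- The coordinates of a fully discrete solution are mixtures of powers of the backward Euler
amplification factor. -/
theorem IsFullyDiscreteSolution.l2Inner_eq (hμc : ContinuousOn μ (Icc 0 1))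
    (hμ0 : ∀ α ∈ Icc (0 : ℝ) 1, 0 ≤ μ α) (hμp : 0 < μ 0) (hΩ : IsConvexPolygonalDomain Ω)
    {τ : ℝ} (hτ : 0 < τ) {N : ℕ} {vh : EuclideanSpace ℝ (Fin d) → ℝ} (hvh : vh ∈ feSpace Ω K)
    {U : ℕ → EuclideanSpace ℝ (Fin d) → ℝ} (hU : IsFullyDiscreteSolution μ τ N Ω K vh U)
    {lam : ℝ} (hlam : 0 ≤ lam) {e : EuclideanSpace ℝ (Fin d) → ℝ} (he : e ∈ feSpace Ω K)
    (hel : ∀ f ∈ feSpace Ω K, dirichletForm Ω e f = lam * l2Inner Ω e f)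
    {ν : Measure ℝ} [IsFiniteMeasure ν] (hν : ∀ᵐ r ∂ν, 0 ≤ r)
    (hs : ∀ s : ℝ, 0 < s → ∫ r, (s + r)⁻¹ ∂ν = symbol μ s / (s * (symbol μ s + lam)))
    {n : ℕ} (hn : n ∈ Finset.Icc 1 N) :
    l2Inner Ω e (U n) = l2Inner Ω e vh * ∫ r, ((1 + τ * r) ^ n)⁻¹ ∂ν := by
  refine cqSum_unique hμc hμ0 hμp hlam hτ (Y := fun j => l2Inner Ω e (U j))
    (Z := fun j => l2Inner Ω e vh * ∫ r, ((1 + τ * r) ^ j)⁻¹ ∂ν) (fun m hm => ?_) n hn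
  have hm' := Finset.mem_Icc.1 hm
  have hmem : ∀ j ∈ Finset.Icc 1 m, U j ∈ feSpace Ω K := fun j hj =>
    (hU.equation j (Finset.mem_Icc.2
      ⟨(Finset.mem_Icc.1 hj).1, (Finset.mem_Icc.1 hj).2.trans hm'.2⟩)).1
  -- Membership is carried along in the induction because `l2Inner_add_left` requires square
  -- integrable arguments.
  have hsum : ∀ s ⊆ Finset.Icc 1 m, ∑ j ∈ s, cqWeight μ τ (m - j) • U j ∈ feSpace Ω K ∧
      l2Inner Ω e (∑ j ∈ s, cqWeight μ τ (m - j) • U j) =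
        ∑ j ∈ s, cqWeight μ τ (m - j) * l2Inner Ω e (U j) := by
    classical
    intro s hsub
    induction s using Finset.induction_on with
    | empty => exact ⟨by simp, by simp [l2Inner]⟩
    | insert a s ha ih =>
      obtain ⟨ih1, ih2⟩ := ih ((Finset.subset_insert a s).trans hsub)
      have hUa := (feSpace Ω K).smul_mem (cqWeight μ τ (m - a))
        (hmem a (hsub (Finset.mem_insert_self a s)))
      rw [Finset.sum_insert ha, Finset.sum_insert ha]
      refine ⟨(feSpace Ω K).add_mem hUa ih1, ?_⟩
      rw [l2Inner_comm, l2Inner_add_left (memLp_of_mem_feSpace hΩ hUa)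
        (memLp_of_mem_feSpace hΩ ih1) (memLp_of_mem_feSpace hΩ he), l2Inner_smul_left,
        l2Inner_comm _ e, l2Inner_comm _ e, ih2]
  obtain ⟨hQ, hQ'⟩ := hsum _ subset_rfl
  have hvQ := (feSpace Ω K).smul_mem (cqSum μ τ (fun _ => (1 : ℝ)) m) hvh
  have hL := l2Inner_negDiscreteLaplacian he hel (hU.equation m hm)
  have hneg : (-1 : ℝ) • cqSum μ τ U m ∈ feSpace Ω K := (feSpace Ω K).smul_mem (-1) hQ
  rw [sub_eq_add_neg, ← neg_one_smul ℝ (cqSum μ τ U m), l2Inner_comm,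
    l2Inner_add_left (memLp_of_mem_feSpace hΩ hvQ) (memLp_of_mem_feSpace hΩ hneg)
      (memLp_of_mem_feSpace hΩ he), l2Inner_smul_left, l2Inner_smul_left,
    l2Inner_comm _ e, l2Inner_comm _ e] at hL
  have hQ'' : l2Inner Ω e (cqSum μ τ U m) = cqSum μ τ (fun j => l2Inner Ω e (U j)) m := hQ'
  have hmix := cqSum_mixture hμc hμ0 hμp hlam hτ hν hs hm'.1
  have hscale : cqSum μ τ (fun j => l2Inner Ω e vh * ∫ r, ((1 + τ * r) ^ j)⁻¹ ∂ν) m =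
      l2Inner Ω e vh * cqSum μ τ (fun j => ∫ r, ((1 + τ * r) ^ j)⁻¹ ∂ν) m := by
    simp only [cqSum, Finset.mul_sum, smul_eq_mul]
    exact Finset.sum_congr rfl fun j _ => by ring
  rw [hscale, ← hQ'']
  have h2 : l2Inner Ω e vh * cqSum μ τ (fun j => ∫ r, ((1 + τ * r) ^ j)⁻¹ ∂ν) m +
      lam * (l2Inner Ω e vh * ∫ r, ((1 + τ * r) ^ m)⁻¹ ∂ν) =
      l2Inner Ω e vh * cqSum μ τ (fun _ => (1 : ℝ)) m := by
    rw [← hmix]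
    ring
  rw [h2]
  linarith

end FiniteElement

end DistributedOrder

/-! ### The error estimate. -/

open DistributedOrder in
theorem theorem5p1 (μ : ℝ → ℝ) (hμ_cont : ContinuousOn μ (Set.Icc 0 1))
    (hμ_nonneg : ∀ α ∈ Set.Icc (0 : ℝ) 1, 0 ≤ μ α) (hμ_pos : 0 < μ 0 * μ 1) :
    ∃ c : ℝ, 0 < c ∧
      ∀ d : ℕ, 1 ≤ d → d ≤ 3 →
      ∀ Ω : Set (EuclideanSpace ℝ (Fin d)), DistributedOrder.IsConvexPolygonalDomain Ω →
      ∀ K : Geometry.SimplicialComplex ℝ (EuclideanSpace ℝ (Fin d)),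
        DistributedOrder.IsTriangulation Ω K →
      ∀ T : ℝ, 0 < T → ∀ N : ℕ, 1 ≤ N → ∀ τ : ℝ, τ = T / (N : ℝ) →
      ∀ v : EuclideanSpace ℝ (Fin d) → ℝ,
        MeasureTheory.MemLp v 2 (MeasureTheory.volume.restrict Ω) →
      ∀ vh : EuclideanSpace ℝ (Fin d) → ℝ, DistributedOrder.IsL2Projection Ω K v vh →
      ∀ u : ℝ → EuclideanSpace ℝ (Fin d) → ℝ,
        DistributedOrder.IsSemidiscreteSolution μ T Ω K vh u →
      ∀ U : ℕ → EuclideanSpace ℝ (Fin d) → ℝ,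
        DistributedOrder.IsFullyDiscreteSolution μ τ N Ω K vh U →
      ∀ n : ℕ, 1 ≤ n → n ≤ N →
        DistributedOrder.l2Norm Ω (u ((n : ℝ) * τ) - U n) ≤
          c * τ * ((n : ℝ) * τ)⁻¹ * DistributedOrder.l2Norm Ω v := by
  have hμ0 : 0 < μ 0 := by
    refine (hμ_nonneg 0 (Set.left_mem_Icc.2 zero_le_one)).lt_of_ne fun h => ?_
    rw [← h, zero_mul] at hμ_pos
    exact lt_irrefl _ hμ_pos
  -- The constant of `abs_exp_sub_inv_pow_le`; averaging over a measure of mass at most 1 does not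
  -- enlarge it.
  refine ⟨4, by norm_num, ?_⟩
  intro d _ _ Ω hΩ K hK T hT N hN τ hτ v hv vh hvh u hu U hU n hn hnN
  have hN0 : (0 : ℝ) < N := by exact_mod_cast hN
  have hn0 : (0 : ℝ) < n := by exact_mod_cast hn
  have hτ0 : 0 < τ := hτ ▸ div_pos hT hN0
  have hmem : (n : ℝ) * τ ∈ Set.Icc 0 T := by
    refine ⟨by positivity, ?_⟩
    have h1 : (n : ℝ) ≤ N := by exact_mod_cast hnN
    calc (n : ℝ) * τ ≤ N * τ := by gcongr
      _ = T := by rw [hτ]; field_simp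
  have hnI : n ∈ Finset.Icc 1 N := Finset.mem_Icc.2 ⟨hn, hnN⟩
  have : FiniteDimensional ℝ (feSpace Ω K) := finiteDimensional_feSpace hK
  obtain ⟨M, e, lam, hlam, hel, hpar⟩ := exists_basis_diagonal (l2Form (K := K) hΩ)
    (energyForm hΩ hK) (fun x y => l2Inner_comm x.1 y.1) (fun x => l2Inner_self_nonneg x.1)
    (fun x hx => Subtype.ext (l2Inner_self_eq_zero hΩ x.2 hx))
    (fun x y => dirichletForm_comm x.1 y.1) (fun x => dirichletForm_self_nonneg x.1)
  have hpar' : ∀ f ∈ feSpace Ω K, l2Inner Ω f f = ∑ i, l2Inner Ω (e i).1 f ^ 2 :=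
    fun f hf => hpar ⟨f, hf⟩
  have hUn := (hU.equation n hnI).1
  have hun := hu.mem _ hmem
  have hdiff : u (n * τ) - U n ∈ feSpace Ω K := (feSpace Ω K).sub_mem hun hUn
  -- Both coordinates are the same multiple of integrals against the same measure ν, which depends
  -- on the eigenvalue; the bound does not.
  have hcoord : ∀ i, |l2Inner Ω (e i).1 (u (n * τ) - U n)| ≤ 4 / n * |l2Inner Ω (e i).1 vh| := by
    intro i
    obtain ⟨ν, hν1, hν, hs⟩ := exists_stieltjes_measure hμ_cont hμ_nonneg hμ0 (hlam i)
    have hfin : MeasureTheory.IsFiniteMeasure ν := ⟨hν1.trans_lt ENNReal.one_lt_top⟩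
    have hel' : ∀ f ∈ feSpace Ω K,
        dirichletForm Ω (e i).1 f = lam i * l2Inner Ω (e i).1 f := fun f hf => hel i ⟨f, hf⟩
    have h1 : l2Inner Ω (e i).1 (u (n * τ) - U n) =
        l2Inner Ω (e i).1 (u (n * τ)) - l2Inner Ω (e i).1 (U n) :=
      map_sub (l2Form (K := K) hΩ (e i)) ⟨_, hun⟩ ⟨_, hUn⟩
    rw [h1, hu.l2Inner_eq hμ_cont hμ_nonneg hμ0 hΩ hK hT (hlam i) (e i).2 hel' hν hs hmem,
      hU.l2Inner_eq hμ_cont hμ_nonneg hμ0 hΩ hτ0 hvh.1 (hlam i) (e i).2 hel' hν hs hnI,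
      ← mul_sub, abs_mul, mul_comm]
    exact mul_le_mul_of_nonneg_right (abs_mixture_sub_le hν1 hν hτ0 hn) (abs_nonneg _)
  -- Parseval's identity on both sides, so the coordinatewise factor becomes a factor of the norm.
  have hnorm : l2Norm Ω (u (n * τ) - U n) ≤ 4 / n * l2Norm Ω vh := by
    rw [l2Norm_eq_sqrt (memLp_of_mem_feSpace hΩ hdiff),
      l2Norm_eq_sqrt (memLp_of_mem_feSpace hΩ hvh.1), hpar' _ hdiff, hpar' _ hvh.1]
    refine Real.sqrt_le_iff.2 ⟨by positivity, ?_⟩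
    rw [mul_pow, Real.sq_sqrt (Finset.sum_nonneg fun i _ => sq_nonneg _), Finset.mul_sum]
    refine Finset.sum_le_sum fun i _ => ?_
    rw [← mul_pow, ← sq_abs, ← sq_abs (4 / (n : ℝ) * _), abs_mul (4 / (n : ℝ)),
      abs_of_nonneg (by positivity : (0 : ℝ) ≤ 4 / n)]
    exact pow_le_pow_left₀ (abs_nonneg _) (hcoord i) 2
  refine hnorm.trans ?_
  rw [show 4 * τ * ((n : ℝ) * τ)⁻¹ = 4 / n by field_simp]
  exact mul_le_mul_of_nonneg_left (l2Norm_projection_le hΩ hv hvh) (by positivity)
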